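/- Let $d\ge 1$, let $\mathbb T^d=(\mathbb R/\mathbb Z)^d$, and write $M_{u,T}(v)=(2\pi T)^{-d/2}e^{-|v-u|^2/(2T)}$ for $u,v\in\mathbb R^d$, $T>0$. For a nonnegative function $h(x,v)$ on $\mathbb T^d\times\mathbb R^d$ put $\mathcal N_q(h)=\sup_{x,v}h(x,v)(1+|v|^q)$, and define $\varrho_h,u_h,T_h$ by $$\varrho_h(x)=\int h(x,v)\,dv,\quad \varrho_hu_h(x)=\int h(x,v)\,v\,dv,\quad \varrho_hT_h(x)=\frac1d\int h(x,v)\,|v-u_h(x)|^2\,dv .$$ For a function $\varphi$ on $\mathbb T^d$ define the smeared fields by $$\varrho_h^\varphi=\varphi*\varrho_h,\quad \varrho_h^\varphi u_h^\varphi(x)=\iint\varphi(x-y)h(y,v)\,v\,dv\,dy,\quad \varrho_h^\varphi T_h^\varphi(x)=\frac1d\iint\varphi(x-y)h(y,v)\,|v-u_h^\varphi(x)|^2\,dv\,dy .$$ The BGK equation is $\partial_tf+v\cdot\nabla_xf=\varrho_fM_{u_f,T_f}-f$; the regularized BGK equation with smearing function $\varphi$ is $\partial_tg+v\cdot\nabla_xg=\varrho_g^\varphi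 M_{u_g^\varphi,T_g^\varphi}-g$. A solution of $\partial_tf+v\cdot\nabla_xf=G(f)-f$ with initial datum $f_0$ means a mild solution: a nonnegative measurable function $f(x,v,t)$ on $\mathbb T^d\times\mathbb R^d\times[0,\infty)$ such that, for some $q'>d+2$, $\sup_{t\le\tau}\mathcal N_{q'}(f(t))<\infty$ for all $\tau>0$, and, for all $(x,v,t)$, $$f(x,v,t)=e^{-t}f_0(x-vt,v)+\int_0^te^{-(t-s)}\,G(f(s))(x-v(t-s),v)\,ds .$$ Let $(\varphi_\varepsilon)_{\varepsilon\in(0,1)}$ be a family of strictly positive, even functions in $C^\infty(\mathbb T^d)$ with $\int\varphi_\varepsilon=1$ for which there is a constant $K$ such that, for all $\varepsilon\in(0,1)$, $$\|\varphi_\varepsilon\|_\infty\le K\varepsilon^{-d},\qquad \|\nabla\varphi_\varepsilon\|_\infty\le K\varepsilon^{-(d+1)},\qquad (\min\varphi_\varepsilon)^{-1}\le K\varepsilon^{-1},$$ $$\|\varphi_\varepsilon*J-J\|_\infty\le K\,(\|J\|_\infty+\|\nabla J\|_\infty)\,\varepsilon\qquad\text{for all }J\in C^1(\mathbb T^d).$$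 **Theorem.** Let $f_0$ be a probability density on $\mathbb T^d\times\mathbb R^d$, differentiable in $x$, such that $a(v)\le f_0(x,v)\le C_1e^{-\alpha|v|^2}$ for all $(x,v)$, for some constants $C_1,\alpha>0$ and some continuous function $a\ge0$ on $\mathbb R^d$ with $\int a\,dv>0$. Suppose that $\mathcal N_q(|\nabla_xf_0|)<\infty$ for some $q>d+2$. Then for every $t\ge0$ there is a constant $C$, depending only on $t$, $f_0$ and the family $(\varphi_\varepsilon)$, such that for every $\varepsilon\in(0,1)$, if $f$ is a solution of the BGK equation and $g^\varepsilon$ is a solution of the regularized BGK equation with smearing function $\varphi_\varepsilon$, both with initial datum $f_0$, then $$\int_{\mathbb T^d\times\mathbb R^d}(1+|v|^2)\,|f(x,v,t)-g^\varepsilon(x,v,t)|\,dx\,dv\le C\varepsilon .$$ -/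

import Mathlib

open MeasureTheory Set
open scoped NNReal ENNReal ContDiff

noncomputable section

namespace BGK

/-- The `d`-dimensional torus of side length one (its volume is the Haar probability measure). -/
abbrev Torus (d : ℕ) : Type := UnitAddTorus (Fin d)

/-- The velocity space `ℝ^d` with its Euclidean norm. -/
abbrev Vel (d : ℕ) : Type := EuclideanSpace ℝ (Fin d)

/-- Phase-space functions `h(x,v)`. -/
abbrev PhaseFun (d : ℕ) : Type := Torus d → Vel d → ℝ

variable {d : ℕ}

/-- The covering map `ℝ^d → 𝕋^d`. -/
def proj (z : Vel d) : Torus d := fun i => ((z i : ℝ) : UnitAddCircle)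

/-- `J` is of class `C^n` on the torus: its periodic lift to `ℝ^d` is. -/
def TorusContDiff (n : WithTop ℕ∞) (J : Torus d → ℝ) : Prop :=
  ContDiff ℝ n fun z : Vel d => J (proj z)

/-- `J` is differentiable at every point of the torus: its periodic lift to `ℝ^d` is. -/
def TorusDifferentiable (J : Torus d → ℝ) : Prop :=
  Differentiable ℝ fun z : Vel d => J (proj z)

/-- The gradient of `J` at the point `x` of the torus. -/
def torusGrad (J : Torus d → ℝ) (x : Torus d) : Vel d :=
  gradient (fun z : Vel d => J (x + proj z)) 0

/-- The sup norm, with values in `[0,∞]`. -/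
def supNorm {α E : Type*} [SeminormedAddGroup E] (F : α → E) : ℝ≥0∞ := ⨆ x, ‖F x‖ₑ

/-- The weighted sup norm `𝓝_q(h) = sup_{x,v} h(x,v) (1 + |v|^q)` of a nonnegative function `h`,
with values in `[0,∞]`. -/
def weightedSup (q : ℝ) (h : PhaseFun d) : ℝ≥0∞ :=
  ⨆ (x : Torus d) (v : Vel d), ENNReal.ofReal (h x v * (1 + ‖v‖ ^ q))

/-- The normalized Maxwellian density `M_{u,T}(v)`. -/
def maxwellian (u : Vel d) (T : ℝ) (v : Vel d) : ℝ :=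
  1 / (2 * Real.pi * T) ^ ((d : ℝ) / 2) * Real.exp (-‖v - u‖ ^ 2 / (2 * T))

/-- Local density `ϱ_h(x)`. -/
def density (h : PhaseFun d) (x : Torus d) : ℝ := ∫ v, h x v

/-- Local velocity `u_h(x)`. -/
def velocity (h : PhaseFun d) (x : Torus d) : Vel d :=
  (density h x)⁻¹ • ∫ v, h x v • v

/-- Local temperature `T_h(x)`. -/
def temperature (h : PhaseFun d) (x : Torus d) : ℝ :=
  (density h x)⁻¹ * (1 / (d : ℝ) * ∫ v, h x v * ‖v - velocity h x‖ ^ 2)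

/-- The gain term `ϱ_h M_h` of the BGK equation. -/
def gain (h : PhaseFun d) : PhaseFun d := fun x v =>
  density h x * maxwellian (velocity h x) (temperature h x) v

/-- Convolution on the torus. -/
def torusConv (φ J : Torus d → ℝ) (x : Torus d) : ℝ := ∫ y, φ (x - y) * J y

/-- Smeared local density `ϱ_h^φ(x)`. -/
def smearedDensity (φ : Torus d → ℝ) (h : PhaseFun d) (x : Torus d) : ℝ :=
  torusConv φ (density h) x

/-- Smeared local velocity `u_h^φ(x)`. -/
def smearedVelocity (φ : Torus d → ℝ) (h : PhaseFun d) (x : Torus d) : Vel d :=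
  (smearedDensity φ h x)⁻¹ • ∫ y, ∫ v, (φ (x - y) * h y v) • v

/-- Smeared local temperature `T_h^φ(x)`. -/
def smearedTemperature (φ : Torus d → ℝ) (h : PhaseFun d) (x : Torus d) : ℝ :=
  (smearedDensity φ h x)⁻¹ *
    (1 / (d : ℝ) * ∫ y, ∫ v, φ (x - y) * h y v * ‖v - smearedVelocity φ h x‖ ^ 2)

/-- The gain term `ϱ_h^φ M_h^φ` of the regularized BGK equation. -/
def smearedGain (φ : Torus d → ℝ) (h : PhaseFun d) : PhaseFun d := fun x v =>
  smearedDensity φ h x * maxwellian (smearedVelocity φ h x) (smearedTemperature φ h x) v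

/-- `f` is a mild solution, for times `t ≥ 0`, of `∂_t f + v·∇_x f = G(f) - f` with initial datum
`f₀`, in the class of nonnegative measurable functions such that, for some `q > d + 2`,
`sup_{t ≤ τ} 𝓝_q(f(t)) < ∞` for all `τ > 0`. -/
structure IsMildSolution (G : PhaseFun d → PhaseFun d) (f₀ : PhaseFun d)
    (f : ℝ → PhaseFun d) : Prop where
  measurable : Measurable fun p : ℝ≥0 × Torus d × Vel d => f (p.1 : ℝ) p.2.1 p.2.2
  nonneg : ∀ t, 0 ≤ t → ∀ x v, 0 ≤ f t x v
  bounded : ∃ q : ℝ, (d : ℝ) + 2 < q ∧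
    ∀ τ : ℝ, 0 < τ → ⨆ t ∈ Icc (0 : ℝ) τ, weightedSup q (f t) < ⊤
  integrable : ∀ t, 0 ≤ t → ∀ x v, IntervalIntegrable
    (fun s => Real.exp (-(t - s)) * G (f s) (x - proj ((t - s) • v)) v) volume 0 t
  duhamel : ∀ t, 0 ≤ t → ∀ x v, f t x v =
    Real.exp (-t) * f₀ (x - proj (t • v)) v +
      ∫ s in (0 : ℝ)..t, Real.exp (-(t - s)) * G (f s) (x - proj ((t - s) • v)) v

/-- Solution of the BGK equation. -/
def IsBGKSolution (f₀ : PhaseFun d) (f : ℝ → PhaseFun d) : Prop :=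
  IsMildSolution gain f₀ f

/-- Solution of the regularized BGK equation with smearing function `φ`. -/
def IsRegularizedBGKSolution (φ : Torus d → ℝ) (f₀ : PhaseFun d) (g : ℝ → PhaseFun d) : Prop :=
  IsMildSolution (smearedGain φ) f₀ g

/-- `f₀` is a probability density on `𝕋^d × ℝ^d`. -/
structure IsProbDensity (f₀ : PhaseFun d) : Prop where
  measurable : Measurable fun p : Torus d × Vel d => f₀ p.1 p.2
  nonneg : ∀ x v, 0 ≤ f₀ x v
  integral_eq_one : ∫ p : Torus d × Vel d, f₀ p.1 p.2 = 1

/-- The upper and lower bounds on the initial datum: `a(v) ≤ f₀(x,v) ≤ C₁ exp(-α|v|²)` with `a`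
continuous, nonnegative, of positive integral. -/
def GaussianBounds (f₀ : PhaseFun d) : Prop :=
  ∃ (a : Vel d → ℝ) (C₁ α : ℝ), Continuous a ∧ 0 < C₁ ∧ 0 < α ∧
    (∀ x v, a v ≤ f₀ x v ∧ f₀ x v ≤ C₁ * Real.exp (-α * ‖v‖ ^ 2)) ∧
    (∀ v, 0 ≤ a v) ∧ 0 < ∫ v, a v

/-- A strictly positive, even, smooth smearing function of integral one. -/
structure IsSmearing (φ : Torus d → ℝ) : Prop where
  smooth : TorusContDiff ∞ φ
  pos : ∀ x, 0 < φ x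
  even : ∀ x, φ (-x) = φ x
  integral_eq_one : ∫ y, φ y = 1

/-- The constant `C_φ = (min φ)⁻¹`. -/
def invMin (φ : Torus d → ℝ) : ℝ := (⨅ x, φ x)⁻¹

/-- A family of smearing functions `φ_ε`, `ε ∈ (0,1)`, approximating the Dirac mass:
`‖φ_ε‖_∞ ≤ K ε^{-d}`, `‖∇φ_ε‖_∞ ≤ K ε^{-(d+1)}`, `C_{φ_ε} ≤ K ε^{-1}`, and
`‖φ_ε * J - J‖_∞ ≤ K (‖J‖_∞ + ‖∇J‖_∞) ε` for all `J ∈ C^1`, with `K` independent of `ε`, `J`. -/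
structure IsSmearingFamily (φ : ℝ → Torus d → ℝ) : Prop where
  smearing : ∀ ε ∈ Ioo (0 : ℝ) 1, IsSmearing (φ ε)
  bounds : ∃ K : ℝ, 0 < K ∧ ∀ ε ∈ Ioo (0 : ℝ) 1,
    supNorm (φ ε) ≤ ENNReal.ofReal (K / ε ^ d) ∧
    supNorm (torusGrad (φ ε)) ≤ ENNReal.ofReal (K / ε ^ (d + 1)) ∧
    invMin (φ ε) ≤ K / ε ∧
    ∀ J : Torus d → ℝ, TorusContDiff 1 J →
      supNorm (fun x => torusConv (φ ε) J x - J x) ≤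
        ENNReal.ofReal K * (supNorm J + supNorm (torusGrad J)) * ENNReal.ofReal ε

end BGK

end

/-! Both gain terms are one nonlinear map evaluated at different densities. For a density h of the
velocity alone, `localGain h` is the Maxwellian with the moments of h. The BGK gain at x is
`localGain` of f(x,·); by Fubini the regularized gain is `localGain` of the spatial average φ_ε * g
at x, because smeared moments are the moments of the averaged density. Since φ_ε is a probability
kernel, averaging preserves weighted sup bounds and x-independent lower bounds, so every estimate is
uniform in ε.

Two facts about `localGain` in the norm sup h(v)(1+|v|^q), q > d+2, carry the proof. By
`exists_localGain_le` it is bounded by A times the norm of h, with A depending only on d and q. By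
`exists_localGain_lipschitz` it is Lipschitz on densities of bounded norm and mass bounded below:
such densities cannot concentrate, so their temperature stays away from zero (`exists_temp_lower`).

Positivity of the gain keeps solutions above a damped copy of a(v), which bounds the mass from
below; the linear bound and `gronwall_family` then control the weighted norm
(`exists_apriori_bounds`). Comparing f with its own translates propagates Lipschitz regularity in x
(`exists_lipschitz_bound`). Finally f and φ_ε * g differ by f - φ_ε * f, which is O(ε) by this
regularity, plus an average of f - g. Gronwall gives |f - g|(1+|v|^q) ≤ Cε
(`exists_weighted_sup_rate`), and (1+|v|²)/(1+|v|^q) is integrable. -/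

noncomputable section

namespace BGK

variable {d : ℕ}

/-! ### Functions of the velocity -/

/-- Total mass of a function of the velocity. -/
def mass (h : Vel d → ℝ) : ℝ := ∫ v, h v

/-- Mean velocity. -/
def mean (h : Vel d → ℝ) : Vel d := (mass h)⁻¹ • ∫ v, h v • v

/-- Temperature. -/
def temp (h : Vel d → ℝ) : ℝ := (mass h)⁻¹ * (1 / (d : ℝ) * ∫ v, h v * ‖v - mean h‖ ^ 2)

/-- The Maxwellian with the moments of `h`. -/
def localGain (h : Vel d → ℝ) (v : Vel d) : ℝ := mass h * maxwellian (mean h) (temp h) v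

/-- `h` is measurable, nonnegative and `h(v) (1 + |v|^q) ≤ N`. -/
structure WeightBounded (q N : ℝ) (h : Vel d → ℝ) : Prop where
  measurable : Measurable h
  nonneg : ∀ v, 0 ≤ h v
  bound : ∀ v, h v * (1 + ‖v‖ ^ q) ≤ N

/-! ### Polynomial weights -/

lemma one_le_weight (q : ℝ) (v : Vel d) : 1 ≤ 1 + ‖v‖ ^ q :=
  le_add_of_nonneg_right (Real.rpow_nonneg (norm_nonneg _) _)

lemma weight_pos (q : ℝ) (v : Vel d) : 0 < 1 + ‖v‖ ^ q :=
  zero_lt_one.trans_le (one_le_weight q v)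

lemma one_add_rpow_le {q s : ℝ} (hq : 0 ≤ q) (hs : 0 ≤ s) :
    (1 + s) ^ q ≤ 2 ^ q * (1 + s ^ q) := by
  have h0 := Real.rpow_nonneg hs q
  have h2 : (0 : ℝ) ≤ 2 ^ q := by positivity
  rcases le_total s 1 with h | h
  · calc (1 + s) ^ q ≤ 2 ^ q := Real.rpow_le_rpow (by linarith) (by linarith) hq
      _ ≤ _ := le_mul_of_one_le_right h2 (by linarith)
  · calc (1 + s) ^ q ≤ (2 * s) ^ q := Real.rpow_le_rpow (by linarith) (by linarith) hq
      _ = 2 ^ q * s ^ q := Real.mul_rpow (by norm_num) hs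
      _ ≤ _ := by gcongr; linarith

lemma add_rpow_le_two_mul {q a b : ℝ} (hq : 0 ≤ q) (ha : 0 ≤ a) (hb : 0 ≤ b) :
    (a + b) ^ q ≤ 2 ^ q * (a ^ q + b ^ q) := by
  have h0 := Real.rpow_nonneg ha q
  have h1 := Real.rpow_nonneg hb q
  rcases le_total a b with h | h
  · calc (a + b) ^ q ≤ (2 * b) ^ q := Real.rpow_le_rpow (by linarith) (by linarith) hq
      _ = 2 ^ q * b ^ q := Real.mul_rpow (by norm_num) hb
      _ ≤ _ := by gcongr; linarith
  · calc (a + b) ^ q ≤ (2 * a) ^ q := Real.rpow_le_rpow (by linarith) (by linarith) hq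
      _ = 2 ^ q * a ^ q := Real.mul_rpow (by norm_num) ha
      _ ≤ _ := by gcongr; linarith

lemma measurable_weight (q : ℝ) : Measurable fun v : Vel d => 1 + ‖v‖ ^ q :=
  measurable_const.add (measurable_norm.pow_const q)

/-- The quotient decays like (1+|v|)^(-(q-2)), and q-2 > d. This is the source of the threshold d+2.
-/
lemma integrable_weight {q : ℝ} (hq : (d : ℝ) + 2 < q) :
    Integrable fun v : Vel d => (1 + ‖v‖ ^ 2) / (1 + ‖v‖ ^ q) := by
  have hd : (0 : ℝ) ≤ d := Nat.cast_nonneg d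
  have h1 : Integrable fun v : Vel d => 2 ^ q * (1 + ‖v‖) ^ (-(q - 2)) := by
    refine (integrable_one_add_norm ?_).const_mul _
    simp only [finrank_euclideanSpace, Fintype.card_fin]
    linarith
  refine h1.mono' ?_ (Filter.Eventually.of_forall fun v => ?_)
  · exact ((measurable_const.add (measurable_norm.pow_const 2)).div
      (measurable_weight q)).aestronglyMeasurable
  · have hv := norm_nonneg v
    rw [Real.norm_of_nonneg (div_nonneg (by positivity) (weight_pos q v).le),
      div_le_iff₀ (weight_pos q v)]
    have h2 := one_add_rpow_le (by linarith : 0 ≤ q) hv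
    have h3 : (1 + ‖v‖) ^ (-(q - 2)) * (1 + ‖v‖) ^ q = (1 + ‖v‖) ^ 2 := by
      rw [← Real.rpow_add (by positivity), ← Real.rpow_natCast]
      congr 1; push_cast; ring
    have h4 : (0 : ℝ) ≤ (1 + ‖v‖) ^ (-(q - 2)) := by positivity
    calc 1 + ‖v‖ ^ 2 ≤ (1 + ‖v‖) ^ 2 := by nlinarith
      _ = (1 + ‖v‖) ^ (-(q - 2)) * (1 + ‖v‖) ^ q := h3.symm
      _ ≤ (1 + ‖v‖) ^ (-(q - 2)) * (2 ^ q * (1 + ‖v‖ ^ q)) := by gcongr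
      _ = _ := by ring

/-- The constant `∫ (1 + |v|²) / (1 + |v|^q) dv`. -/
def weightIntegral (d : ℕ) (q : ℝ) : ℝ := ∫ v : Vel d, (1 + ‖v‖ ^ 2) / (1 + ‖v‖ ^ q)

lemma weightIntegral_nonneg (d : ℕ) (q : ℝ) : 0 ≤ weightIntegral d q :=
  integral_nonneg fun v => div_nonneg (by positivity) (weight_pos q v).le

/-- Taking F = 1, v, |v|² covers mass, momentum and energy at once. No sign is imposed on h, so
differences of densities are included. -/
lemma integrable_smul_of_bound {E : Type*} [NormedAddCommGroup E] [NormedSpace ℝ E]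
    {q N B : ℝ} (hq : (d : ℝ) + 2 < q) {h : Vel d → ℝ} (hm : Measurable h)
    (hb : ∀ v, |h v| * (1 + ‖v‖ ^ q) ≤ N) {F : Vel d → E} (hF : AEStronglyMeasurable F volume)
    (hFb : ∀ v, ‖F v‖ ≤ B * (1 + ‖v‖ ^ 2)) :
    Integrable (fun v => h v • F v) ∧ ‖∫ v, h v • F v‖ ≤ N * B * weightIntegral d q := by
  have hi := (integrable_weight hq).const_mul (N * B)
  have hle : ∀ v, ‖h v • F v‖ ≤ N * B * ((1 + ‖v‖ ^ 2) / (1 + ‖v‖ ^ q)) := fun v => by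
    rw [norm_smul, Real.norm_eq_abs, ← mul_div_assoc, le_div_iff₀ (weight_pos q v)]
    have h1 := hb v
    have h0 : 0 ≤ |h v| * (1 + ‖v‖ ^ q) := mul_nonneg (abs_nonneg _) (weight_pos q v).le
    calc |h v| * ‖F v‖ * (1 + ‖v‖ ^ q) = (|h v| * (1 + ‖v‖ ^ q)) * ‖F v‖ := by ring
      _ ≤ N * (B * (1 + ‖v‖ ^ 2)) := mul_le_mul h1 (hFb v) (norm_nonneg _) (h0.trans h1)
      _ = _ := by ring
  refine ⟨hi.mono' (hm.aestronglyMeasurable.smul hF) (.of_forall hle), ?_⟩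
  rw [weightIntegral, ← integral_const_mul]
  exact norm_integral_le_of_norm_le hi (.of_forall hle)

/-! ### Moments of a weight-bounded density -/

namespace WeightBounded

variable {q N : ℝ} {h : Vel d → ℝ}

lemma abs_bound (H : WeightBounded q N h) (v : Vel d) : |h v| * (1 + ‖v‖ ^ q) ≤ N := by
  rw [abs_of_nonneg (H.nonneg v)]; exact H.bound v

lemma const_nonneg (H : WeightBounded q N h) : 0 ≤ N :=
  (mul_nonneg (H.nonneg 0) (weight_pos q 0).le).trans (H.bound 0)

lemma le_const (H : WeightBounded q N h) (v : Vel d) : h v ≤ N :=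
  (le_mul_of_one_le_right (H.nonneg v) (one_le_weight q v)).trans (H.bound v)

lemma integrable_smul {E : Type*} [NormedAddCommGroup E] [NormedSpace ℝ E]
    (H : WeightBounded q N h) (hq : (d : ℝ) + 2 < q) {F : Vel d → E} {B : ℝ}
    (hF : Continuous F) (hFb : ∀ v, ‖F v‖ ≤ B * (1 + ‖v‖ ^ 2)) :
    Integrable fun v => h v • F v :=
  (integrable_smul_of_bound hq H.measurable H.abs_bound hF.aestronglyMeasurable hFb).1

lemma integrable (H : WeightBounded q N h) (hq : (d : ℝ) + 2 < q) : Integrable h := by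
  have := H.integrable_smul hq (F := fun _ => (1 : ℝ)) (B := 1) continuous_const
    (fun v => by simp)
  simpa using this

lemma integrable_smul_id (H : WeightBounded q N h) (hq : (d : ℝ) + 2 < q) :
    Integrable fun v => h v • v :=
  H.integrable_smul hq (F := fun v => v) (B := 1) continuous_id
    (fun v => by nlinarith [sq_nonneg (‖v‖ - 1)])

lemma integrable_mul_sq (H : WeightBounded q N h) (hq : (d : ℝ) + 2 < q) :
    Integrable fun v => h v * ‖v‖ ^ 2 :=
  H.integrable_smul hq (F := fun v => ‖v‖ ^ 2) (B := 1) (by fun_prop) (fun v => by simp)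

lemma integrable_mul_sq_sub (H : WeightBounded q N h) (hq : (d : ℝ) + 2 < q) (w : Vel d) :
    Integrable fun v => h v * ‖v - w‖ ^ 2 :=
  H.integrable_smul hq (F := fun v => ‖v - w‖ ^ 2) (B := 2 + 2 * ‖w‖ ^ 2) (by fun_prop)
    (fun v => by
      rw [Real.norm_of_nonneg (by positivity)]
      have h1 := norm_sub_le v w
      have h2 : ‖v - w‖ ^ 2 ≤ (‖v‖ + ‖w‖) ^ 2 := by gcongr
      nlinarith [sq_nonneg (‖v‖ - ‖w‖), mul_nonneg (sq_nonneg ‖w‖) (sq_nonneg ‖v‖)])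

lemma mass_nonneg (H : WeightBounded q N h) : 0 ≤ mass h := integral_nonneg H.nonneg

lemma temp_nonneg (H : WeightBounded q N h) : 0 ≤ temp h :=
  mul_nonneg (inv_nonneg.2 H.mass_nonneg) (mul_nonneg (by positivity)
    (integral_nonneg fun v => mul_nonneg (H.nonneg v) (by positivity)))

lemma integral_sq_sub_mean (hd : 1 ≤ d) (hρ : 0 < mass h) :
    ∫ v, h v * ‖v - mean h‖ ^ 2 = mass h * (d * temp h) := by
  have : (d : ℝ) ≠ 0 := by positivity
  rw [temp]; field_simp

lemma mass_smul_mean (hρ : 0 < mass h) : mass h • mean h = ∫ v, h v • v := by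
  rw [mean, smul_inv_smul₀ hρ.ne']

/-- `∫ h |v|² = ϱ (d T + |u|²)`. -/
lemma integral_sq (H : WeightBounded q N h) (hq : (d : ℝ) + 2 < q) (hd : 1 ≤ d)
    (hρ : 0 < mass h) : ∫ v, h v * ‖v‖ ^ 2 = mass h * (d * temp h + ‖mean h‖ ^ 2) := by
  have h1 : ∀ v, h v * ‖v - mean h‖ ^ 2 =
      h v * ‖v‖ ^ 2 - 2 * inner ℝ (mean h) (h v • v) + ‖mean h‖ ^ 2 * h v := fun v => by
    rw [norm_sub_sq_real, inner_smul_right, real_inner_comm]; ring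
  have h2 := integral_sq_sub_mean hd hρ
  have i1 := H.integrable_mul_sq hq
  have i2 := H.integrable_smul_id hq
  have i3 : Integrable fun v => 2 * inner ℝ (mean h) (h v • v) := (i2.const_inner _).const_mul 2
  simp_rw [h1] at h2
  rw [integral_add (f := fun v => h v * ‖v‖ ^ 2 - 2 * inner ℝ (mean h) (h v • v)) (i1.sub i3)
      ((H.integrable hq).const_mul _), integral_sub i1 i3,
    integral_const_mul, integral_const_mul, integral_inner i2, ← mass_smul_mean hρ,
    inner_smul_right, real_inner_self_eq_norm_sq] at h2
  change _ + _ * mass h = _ at h2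
  linarith

/-- Concentration of mass near the mean velocity. -/
lemma mass_le_of_ball (H : WeightBounded q N h) (hq : (d : ℝ) + 2 < q) (hd : 1 ≤ d)
    (hρ : 0 < mass h) {R B : ℝ} (hR : 0 < R) (hTR : 2 * (d * temp h) ≤ R ^ 2)
    (hB : ∀ v ∈ Metric.closedBall (mean h) R, h v ≤ B) :
    mass h ≤ 2 * (B * volume.real (Metric.ball (0 : Vel d) 1) * R ^ d) := by
  have hi := H.integrable hq
  set S := Metric.closedBall (mean h) R
  have hS : MeasurableSet S := Metric.isClosed_closedBall.measurableSet
  -- Chebyshev: outside the ball, 1 ≤ |v-u|²/R².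
  have h1 : ∀ v, h v ≤ S.indicator h v + (R ^ 2)⁻¹ * (h v * ‖v - mean h‖ ^ 2) := fun v => by
    by_cases hv : v ∈ S
    · rw [indicator_of_mem hv]
      have := H.nonneg v
      exact le_add_of_nonneg_right (by positivity)
    · rw [indicator_of_notMem hv, zero_add]
      have h2 : R < ‖v - mean h‖ := by simpa [S, dist_eq_norm] using hv
      have h3 : R ^ 2 ≤ ‖v - mean h‖ ^ 2 := by gcongr
      rw [inv_mul_eq_div, le_div_iff₀ (by positivity)]
      exact mul_le_mul_of_nonneg_left h3 (H.nonneg v)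
  have h2 : mass h ≤ ∫ v, (S.indicator h v + (R ^ 2)⁻¹ * (h v * ‖v - mean h‖ ^ 2)) :=
    integral_mono hi ((hi.indicator hS).add ((H.integrable_mul_sq_sub hq _).const_mul _)) h1
  rw [integral_add (hi.indicator hS) ((H.integrable_mul_sq_sub hq _).const_mul _),
    integral_indicator hS, integral_const_mul, integral_sq_sub_mean hd hρ] at h2
  have h3 : ∫ v in S, h v ≤ B * volume.real S := by
    refine (Real.le_norm_self _).trans (norm_setIntegral_le_of_norm_le_const
      (s := S) (isCompact_closedBall _ _).measure_lt_top fun v hv => ?_)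
    rw [Real.norm_of_nonneg (H.nonneg v)]; exact hB v hv
  rw [Measure.addHaar_real_closedBall _ _ hR.le, finrank_euclideanSpace, Fintype.card_fin] at h3
  -- Since 2dT ≤ R², at most half of the mass lies outside the ball and is absorbed on the left.
  have h4 : (R ^ 2)⁻¹ * (mass h * (d * temp h)) ≤ mass h / 2 := by
    rw [inv_mul_eq_div, div_le_iff₀ (by positivity)]
    nlinarith
  linarith

end WeightBounded

/-! ### The linear weighted bound for the Maxwellian -/

/-- With p = q/2 and s = βy²/p, raise s ≤ e^s to the power p and use y^q = (p/β)^p s^p. -/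
lemma rpow_mul_exp_neg_sq_le {q β y : ℝ} (hq : 0 < q) (hβ : 0 < β) (hy : 0 ≤ y) :
    y ^ q * Real.exp (-β * y ^ 2) ≤ (q / 2 / β) ^ (q / 2) := by
  have hp : 0 < q / 2 := by linarith
  have h1 : β * y ^ 2 / (q / 2) ≤ Real.exp (β * y ^ 2 / (q / 2)) := by
    linarith [Real.add_one_le_exp (β * y ^ 2 / (q / 2))]
  have h2 : (β * y ^ 2 / (q / 2)) ^ (q / 2) ≤ Real.exp (β * y ^ 2) := by
    refine (Real.rpow_le_rpow (by positivity) h1 hp.le).trans_eq ?_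
    rw [← Real.exp_mul, div_mul_cancel₀ _ hp.ne']
  have h3 : y ^ q = (q / 2 / β) ^ (q / 2) * (β * y ^ 2 / (q / 2)) ^ (q / 2) := by
    rw [← Real.mul_rpow (by positivity) (by positivity)]
    have : q / 2 / β * (β * y ^ 2 / (q / 2)) = y ^ 2 := by field_simp
    rw [this, ← Real.rpow_natCast, ← Real.rpow_mul hy]
    congr 1; push_cast; ring
  have h4 : Real.exp (β * y ^ 2) * Real.exp (-β * y ^ 2) = 1 := by
    rw [← Real.exp_add]; simp
  rw [h3, mul_assoc]
  refine mul_le_of_le_one_right (by positivity) ?_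
  rw [← h4]
  gcongr

lemma maxwellian_nonneg {u : Vel d} {T : ℝ} (hT : 0 ≤ T) (v : Vel d) : 0 ≤ maxwellian u T v := by
  unfold maxwellian; positivity

/-- The volume of the unit ball of `Vel d`. -/
def ballVolume (d : ℕ) : ℝ := volume.real (Metric.ball (0 : Vel d) 1)

lemma ballVolume_nonneg (d : ℕ) : 0 ≤ ballVolume d := measureReal_nonneg

/-- The constant `∫ (1 + |z|)^(2 - q) dz`. -/
def tailIntegral (d : ℕ) (q : ℝ) : ℝ := ∫ z : Vel d, (1 + ‖z‖) ^ (-(q - 2))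

lemma tailIntegral_nonneg (d : ℕ) (q : ℝ) : 0 ≤ tailIntegral d q :=
  integral_nonneg fun z => by positivity

/-- A small temperature would put half of the mass in a small ball about the mean, where h ≤ N
leaves room for too little of it. -/
lemma exists_temp_lower (hd : 1 ≤ d) {q N c : ℝ} (hq : (d : ℝ) + 2 < q) (hN : 0 ≤ N)
    (hc : 0 < c) :
    ∃ T₀ : ℝ, 0 < T₀ ∧ ∀ h : Vel d → ℝ, WeightBounded q N h → c ≤ mass h → T₀ ≤ temp h := by
  have hκ := ballVolume_nonneg d
  have hNκ : 0 < N * ballVolume d + 1 := by positivity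
  have hd0 : (0 : ℝ) < d := by exact_mod_cast hd
  -- R ≤ 1 gives R^d ≤ R, and the second entry makes twice the mass allowed in the ball less than c.
  set R := min 1 (c / (4 * (N * ballVolume d + 1))) with hRdef
  have hR : 0 < R := lt_min one_pos (by positivity)
  refine ⟨R ^ 2 / (2 * d), by positivity, fun h H hρ => ?_⟩
  by_contra! hlt
  rw [lt_div_iff₀ (by positivity)] at hlt
  have h1 := H.mass_le_of_ball hq hd (hc.trans_le hρ) hR (by linarith) fun v _ => H.le_const v
  change _ ≤ 2 * (N * ballVolume d * R ^ d) at h1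
  have h2 : R ^ d ≤ R := pow_le_of_le_one hR.le (min_le_left _ _) (by omega)
  have h3 : R ≤ c / (4 * (N * ballVolume d + 1)) := min_le_right _ _
  rw [le_div_iff₀ (by positivity)] at h3
  have h4 : N * ballVolume d * R ^ d ≤ N * ballVolume d * R := by gcongr
  nlinarith

namespace WeightBounded

variable {q N : ℝ} {h : Vel d → ℝ}

lemma temp_pos (H : WeightBounded q N h) (hd : 1 ≤ d) (hq : (d : ℝ) + 2 < q)
    (hρ : 0 < mass h) : 0 < temp h := by
  obtain ⟨T₀, h0, hT⟩ := exists_temp_lower hd hq H.const_nonneg hρ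
  exact h0.trans_le (hT h H le_rfl)

/-- Concentration in the ball of radius √(2dT). Like the bounds for ϱ T^(q/2) and ϱ|u|^q below, it
carries a factor √T^d, which later cancels the prefactor of the Maxwellian. -/
lemma mass_le (H : WeightBounded q N h) (hd : 1 ≤ d) (hq : (d : ℝ) + 2 < q)
    (hρ : 0 < mass h) :
    mass h ≤ 2 * ballVolume d * √(2 * d) ^ d * N * √(temp h) ^ d := by
  have hT := H.temp_pos hd hq hρ
  have hd0 : (0 : ℝ) < d := by exact_mod_cast hd
  have h1 := H.mass_le_of_ball hq hd hρ (R := √(2 * d) * √(temp h)) (by positivity)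
    (by rw [mul_pow, Real.sq_sqrt (by positivity), Real.sq_sqrt hT.le]; linarith)
    fun v _ => H.le_const v
  refine h1.trans_eq ?_
  rw [ballVolume, mul_pow]; ring

/-- Split the energy at |v| = R. Outside, h|v|² ≤ N|v|^(-(q-2)) and |v| ≥ (R/2)(1+|v|/R); rescaling
the tail integral by R produces R^d. -/
lemma mass_mul_temp_le (H : WeightBounded q N h) (hd : 1 ≤ d) (hq : (d : ℝ) + 2 < q)
    (hρ : 0 < mass h) {R : ℝ} (hR : 0 < R) :
    mass h * temp h ≤ R ^ 2 * mass h + N * (R / 2) ^ (-(q - 2)) * (R ^ d * tailIntegral d q) := by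
  have hT := H.temp_pos hd hq hρ
  have hd1 : (1 : ℝ) ≤ d := by exact_mod_cast hd
  have hN := H.const_nonneg
  have hint : Integrable fun z : Vel d => (1 + ‖z‖) ^ (-(q - 2)) := by
    refine integrable_one_add_norm ?_
    simp only [finrank_euclideanSpace, Fintype.card_fin]
    linarith
  have hpt : ∀ v, h v * ‖v‖ ^ 2 ≤
      R ^ 2 * h v + N * (R / 2) ^ (-(q - 2)) * (1 + ‖R⁻¹ • v‖) ^ (-(q - 2)) := fun v => by
    have h0 := H.nonneg v
    rcases le_or_gt ‖v‖ R with hv | hv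
    · have : ‖v‖ ^ 2 ≤ R ^ 2 := by gcongr
      have h5 : 0 ≤ N * (R / 2) ^ (-(q - 2)) * (1 + ‖R⁻¹ • v‖) ^ (-(q - 2)) := by positivity
      nlinarith
    · have hv0 : 0 < ‖v‖ := hR.trans hv
      have h1 : h v * ‖v‖ ^ 2 ≤ N * ‖v‖ ^ (-(q - 2)) := by
        have h2 : ‖v‖ ^ 2 = ‖v‖ ^ q * ‖v‖ ^ (-(q - 2)) := by
          rw [← Real.rpow_add hv0, ← Real.rpow_natCast]; congr 1; push_cast; ring
        have h3 := H.bound v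
        rw [h2, ← mul_assoc]
        gcongr
        nlinarith
      have h2 : R / 2 * (1 + ‖R⁻¹ • v‖) ≤ ‖v‖ := by
        rw [norm_smul, Real.norm_of_nonneg (by positivity : 0 ≤ R⁻¹)]
        field_simp; linarith
      have h3 : ‖v‖ ^ (-(q - 2)) ≤ (R / 2 * (1 + ‖R⁻¹ • v‖)) ^ (-(q - 2)) :=
        Real.rpow_le_rpow_of_nonpos (by positivity) h2 (by linarith)
      rw [Real.mul_rpow (by positivity) (by positivity)] at h3
      have h4 := mul_le_mul_of_nonneg_left h3 hN
      have : 0 ≤ R ^ 2 * h v := by positivity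
      linarith
  have hscale : Integrable fun v : Vel d => (1 + ‖R⁻¹ • v‖) ^ (-(q - 2)) :=
    hint.comp_smul (inv_ne_zero hR.ne')
  have h1 := integral_mono (H.integrable_mul_sq hq)
    (((H.integrable hq).const_mul (R ^ 2)).add (hscale.const_mul (N * (R / 2) ^ (-(q - 2))))) hpt
  rw [H.integral_sq hq hd hρ] at h1
  simp only [Pi.add_apply] at h1
  rw [integral_add ((H.integrable hq).const_mul _)
    (hscale.const_mul _), integral_const_mul, integral_const_mul,
    Measure.integral_comp_inv_smul_of_nonneg volume (fun z : Vel d => (1 + ‖z‖) ^ (-(q - 2))) hR.le,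
    finrank_euclideanSpace, Fintype.card_fin, smul_eq_mul] at h1
  change _ ≤ R ^ 2 * mass h + N * (R / 2) ^ (-(q - 2)) * (R ^ d * tailIntegral d q) at h1
  refine le_trans ?_ h1
  gcongr
  nlinarith [sq_nonneg ‖mean h‖]

/-- Cutting the energy at R = √T/2 turns R²ϱ into ϱT/4, which is absorbed on the left; multiplying
by √T^(q-2) gives the claim. -/
lemma mass_mul_sqrt_temp_rpow_le (H : WeightBounded q N h) (hd : 1 ≤ d) (hq : (d : ℝ) + 2 < q)
    (hρ : 0 < mass h) :
    mass h * √(temp h) ^ q ≤ 2 * 4 ^ (q - 2) * tailIntegral d q * N * √(temp h) ^ d := by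
  have hT := H.temp_pos hd hq hρ
  have hN := H.const_nonneg
  have hJ := tailIntegral_nonneg d q
  have hσ : 0 < √(temp h) := Real.sqrt_pos.2 hT
  have h1 := H.mass_mul_temp_le hd hq hρ (R := √(temp h) / 2) (by positivity)
  rw [← Real.sq_sqrt hT.le] at h1
  rw [Real.sqrt_sq hσ.le] at h1
  set σ := √(temp h)
  have h2 : (σ / 2 / 2) ^ (-(q - 2)) * σ ^ (q - 2) = 4 ^ (q - 2) := by
    rw [Real.rpow_neg (by positivity), ← Real.inv_rpow (by positivity),
      ← Real.mul_rpow (by positivity) hσ.le]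
    congr 1; field_simp; norm_num
  have h3 : σ ^ q = σ ^ 2 * σ ^ (q - 2) := by
    rw [← Real.rpow_natCast, ← Real.rpow_add hσ]; congr 1; push_cast; ring
  have h4 : (σ / 2) ^ d ≤ σ ^ d := by gcongr; linarith
  have h5 : 0 < σ ^ (q - 2) := by positivity
  have h6 : mass h * σ ^ 2 ≤ 2 * (N * (σ / 2 / 2) ^ (-(q - 2)) * (σ ^ d * tailIntegral d q)) := by
    have h7 : N * (σ / 2 / 2) ^ (-(q - 2)) * ((σ / 2) ^ d * tailIntegral d q) ≤
      N * (σ / 2 / 2) ^ (-(q - 2)) * (σ ^ d * tailIntegral d q) := by gcongr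
    nlinarith [mul_pos hρ (pow_pos hσ 2)]
  calc mass h * σ ^ q = mass h * σ ^ 2 * σ ^ (q - 2) := by rw [h3]; ring
    _ ≤ 2 * (N * (σ / 2 / 2) ^ (-(q - 2)) * (σ ^ d * tailIntegral d q)) * σ ^ (q - 2) := by gcongr
    _ = 2 * ((σ / 2 / 2) ^ (-(q - 2)) * σ ^ (q - 2)) * tailIntegral d q * N * σ ^ d := by ring
    _ = _ := by rw [h2]

/-- If |u|² ≥ 8dT, the ball of radius √(2dT) about u lies in |v| ≥ |u|/2, where h ≤ N 2^q/|u|^q, and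
it holds half of the mass. Otherwise |u| is at most a multiple of √T and the temperature bound
applies. -/
lemma mass_mul_mean_rpow_le (H : WeightBounded q N h) (hd : 1 ≤ d) (hq : (d : ℝ) + 2 < q)
    (hρ : 0 < mass h) :
    mass h * ‖mean h‖ ^ q ≤ (2 * ballVolume d * 2 ^ q * √(2 * d) ^ d +
      √(8 * d) ^ q * (2 * 4 ^ (q - 2) * tailIntegral d q)) * N * √(temp h) ^ d := by
  have hT := H.temp_pos hd hq hρ
  have hN := H.const_nonneg
  have hJ := tailIntegral_nonneg d q
  have hκ := ballVolume_nonneg d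
  have hd0 : (0 : ℝ) < d := by exact_mod_cast hd
  have hσ : 0 < √(temp h) := Real.sqrt_pos.2 hT
  rcases le_or_gt (8 * d * temp h) (‖mean h‖ ^ 2) with hu | hu
  · have hu0 : 0 < ‖mean h‖ := by
      by_contra! h0
      have : ‖mean h‖ = 0 := le_antisymm h0 (norm_nonneg _)
      rw [this] at hu
      have : 0 < 8 * d * temp h := by positivity
      linarith
    have hR2 : (√(2 * d) * √(temp h)) ^ 2 = 2 * (d * temp h) := by
      rw [mul_pow, Real.sq_sqrt (by positivity), Real.sq_sqrt hT.le]; ring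
    have hRu : √(2 * d) * √(temp h) ≤ ‖mean h‖ / 2 := by
      refine le_of_sq_le_sq ?_ (by positivity)
      rw [hR2]; nlinarith
    have h1 := H.mass_le_of_ball hq hd hρ (R := √(2 * d) * √(temp h)) (by positivity) hR2.ge
      (B := N * 2 ^ q / ‖mean h‖ ^ q) fun v hv => by
        rw [mem_closedBall_iff_norm] at hv
        have h2 : ‖mean h‖ / 2 ≤ ‖v‖ := by
          have := norm_sub_norm_le (mean h) v
          rw [norm_sub_rev] at this
          linarith
        have h3 : (‖mean h‖ / 2) ^ q ≤ ‖v‖ ^ q :=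
          Real.rpow_le_rpow (by positivity) h2 (by linarith)
        rw [Real.div_rpow hu0.le (by norm_num), div_le_iff₀ (by positivity)] at h3
        rw [le_div_iff₀ (by positivity)]
        have h4 := H.bound v
        have h5 := H.nonneg v
        calc h v * ‖mean h‖ ^ q ≤ h v * (‖v‖ ^ q * 2 ^ q) := by gcongr
          _ ≤ (h v * (1 + ‖v‖ ^ q)) * 2 ^ q := by
              rw [← mul_assoc]; gcongr; linarith
          _ ≤ N * 2 ^ q := by gcongr
    have h2 : 0 < ‖mean h‖ ^ q := by positivity
    change _ ≤ 2 * (N * 2 ^ q / ‖mean h‖ ^ q * ballVolume d * (√(2 * d) * √(temp h)) ^ d) at h1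
    have h3 := mul_le_mul_of_nonneg_right h1 h2.le
    have h4 : 2 * (N * 2 ^ q / ‖mean h‖ ^ q * ballVolume d * (√(2 * d) * √(temp h)) ^ d) *
        ‖mean h‖ ^ q = 2 * ballVolume d * 2 ^ q * √(2 * d) ^ d * N * √(temp h) ^ d := by
      rw [mul_pow]; field_simp
    rw [h4] at h3
    refine h3.trans ?_
    gcongr
    exact le_add_of_nonneg_right (by positivity)
  · have h1 : ‖mean h‖ ≤ √(8 * d) * √(temp h) := by
      rw [← Real.sqrt_mul (by positivity)]
      exact Real.le_sqrt_of_sq_le hu.le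
    have h2 : ‖mean h‖ ^ q ≤ √(8 * d) ^ q * √(temp h) ^ q := by
      rw [← Real.mul_rpow (by positivity) (by positivity)]
      exact Real.rpow_le_rpow (by positivity) h1 (by linarith)
    have h3 := H.mass_mul_sqrt_temp_rpow_le hd hq hρ
    calc mass h * ‖mean h‖ ^ q ≤ mass h * (√(8 * d) ^ q * √(temp h) ^ q) := by gcongr
      _ = √(8 * d) ^ q * (mass h * √(temp h) ^ q) := by ring
      _ ≤ √(8 * d) ^ q * (2 * 4 ^ (q - 2) * tailIntegral d q * N * √(temp h) ^ d) := by gcongr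
      _ = √(8 * d) ^ q * (2 * 4 ^ (q - 2) * tailIntegral d q) * N * √(temp h) ^ d := by ring
      _ ≤ _ := by gcongr; exact le_add_of_nonneg_left (by positivity)

end WeightBounded

/-- Weighted sup bound for the Maxwellian with the moments of `h`, linear in that of `h`. -/
theorem exists_localGain_le (hd : 1 ≤ d) {q : ℝ} (hq : (d : ℝ) + 2 < q) :
    ∃ A : ℝ, 0 < A ∧ ∀ (N : ℝ) (h : Vel d → ℝ), WeightBounded q N h → 0 < mass h →
      ∀ v, localGain h v * (1 + ‖v‖ ^ q) ≤ A * N := by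
  have hκ := ballVolume_nonneg d
  have hJ := tailIntegral_nonneg d q
  have hq0 : 0 < q := by linarith [(Nat.cast_nonneg d : (0 : ℝ) ≤ d)]
  set A₁ := 2 * ballVolume d * √(2 * d) ^ d
  set A₂ := 2 * ballVolume d * 2 ^ q * √(2 * d) ^ d +
      √(8 * d) ^ q * (2 * 4 ^ (q - 2) * tailIntegral d q)
  set A₃ := (q / 2 / (1 / 2)) ^ (q / 2) * (2 * 4 ^ (q - 2) * tailIntegral d q)
  have hA₁ : 0 ≤ A₁ := by positivity
  have hA₂ : 0 ≤ A₂ := by positivity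
  have hA₃ : 0 ≤ A₃ := by positivity
  refine ⟨A₁ + 2 ^ q * (A₂ + A₃) + 1, by positivity, fun N h H hρ v => ?_⟩
  have hN := H.const_nonneg
  have hT := H.temp_pos hd hq hρ
  have hσ : 0 < √(temp h) := Real.sqrt_pos.2 hT
  -- None of these constants involves a lower bound on mass or temperature, so A depends only on d
  -- and q.
  have b1 := H.mass_le hd hq hρ
  have b2 := H.mass_mul_mean_rpow_le hd hq hρ
  have b3 := H.mass_mul_sqrt_temp_rpow_le hd hq hρ
  have hTσ : temp h = √(temp h) ^ 2 := (Real.sq_sqrt hT.le).symm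
  set σ := √(temp h)
  set E := Real.exp (-‖v - mean h‖ ^ 2 / (2 * temp h)) with hE
  have hE0 : 0 < E := Real.exp_pos _
  have hE1 : E ≤ 1 := Real.exp_le_one_iff.2 (by rw [neg_div]; exact neg_nonpos.2 (by positivity))
  have h3 : mass h * (‖v - mean h‖ ^ q * E) ≤ A₃ * N * σ ^ d := by
    have h5 := rpow_mul_exp_neg_sq_le hq0 (β := 1 / 2) (by norm_num)
      (y := ‖v - mean h‖ / σ) (by positivity)
    have h6 : -(1 / 2) * (‖v - mean h‖ / σ) ^ 2 = -‖v - mean h‖ ^ 2 / (2 * temp h) := by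
      rw [hTσ]; field_simp
    rw [h6, ← hE, Real.div_rpow (by positivity) hσ.le, div_mul_eq_mul_div,
      div_le_iff₀ (by positivity)] at h5
    calc mass h * (‖v - mean h‖ ^ q * E)
        ≤ mass h * ((q / 2 / (1 / 2)) ^ (q / 2) * σ ^ q) := by gcongr
      _ = (q / 2 / (1 / 2)) ^ (q / 2) * (mass h * σ ^ q) := by ring
      _ ≤ (q / 2 / (1 / 2)) ^ (q / 2) *
          (2 * 4 ^ (q - 2) * tailIntegral d q * N * σ ^ d) := by gcongr
      _ = _ := by ring
  have hv : ‖v‖ ^ q ≤ 2 ^ q * (‖mean h‖ ^ q + ‖v - mean h‖ ^ q) := by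
    refine le_trans ?_ (add_rpow_le_two_mul hq0.le (norm_nonneg _) (norm_nonneg _))
    refine Real.rpow_le_rpow (norm_nonneg _) ?_ hq0.le
    simpa using norm_add_le (mean h) (v - mean h)
  have hX : mass h * E * (1 + ‖v‖ ^ q) ≤ (A₁ + 2 ^ q * (A₂ + A₃)) * N * σ ^ d := by
    have c1 : mass h * E ≤ A₁ * N * σ ^ d :=
      (mul_le_of_le_one_right hρ.le hE1).trans b1
    have c2 : mass h * ‖mean h‖ ^ q * E ≤ A₂ * N * σ ^ d :=
      (mul_le_of_le_one_right (by positivity) hE1).trans b2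
    calc mass h * E * (1 + ‖v‖ ^ q)
        ≤ mass h * E * (1 + 2 ^ q * (‖mean h‖ ^ q + ‖v - mean h‖ ^ q)) := by gcongr
      _ = mass h * E + 2 ^ q * (mass h * ‖mean h‖ ^ q * E +
          mass h * (‖v - mean h‖ ^ q * E)) := by ring
      _ ≤ A₁ * N * σ ^ d + 2 ^ q * (A₂ * N * σ ^ d + A₃ * N * σ ^ d) := by gcongr
      _ = _ := by ring
  -- The factor √T^d of the three bounds is cancelled by the normalization of the Maxwellian.
  have hP : σ ^ d ≤ (2 * Real.pi * temp h) ^ ((d : ℝ) / 2) := by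
    have : σ ^ d = (temp h) ^ ((d : ℝ) / 2) := by
      rw [hTσ, ← Real.rpow_natCast σ 2, ← Real.rpow_mul hσ.le, ← Real.rpow_natCast]
      congr 1; push_cast; ring
    rw [this]
    refine Real.rpow_le_rpow hT.le ?_ (by positivity)
    nlinarith [Real.pi_gt_three]
  have hσd : 0 < σ ^ d := by positivity
  have hP0 := hσd.trans_le hP
  have hloc : localGain h v * (1 + ‖v‖ ^ q) =
      mass h * E * (1 + ‖v‖ ^ q) / (2 * Real.pi * temp h) ^ ((d : ℝ) / 2) := by
    rw [localGain, maxwellian]; ring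
  rw [hloc, div_le_iff₀ hP0]
  exact hX.trans (mul_le_mul (mul_le_mul_of_nonneg_right (le_add_of_nonneg_right zero_le_one) hN)
    hP hσd.le (by positivity))

/-! ### Dependence of the Maxwellian on its moments -/

/-- The extra (1+|v|)² pays for the quadratic growth in v of the variation of the Maxwellian's
exponent. -/
lemma exists_weight_mul_gaussian_le {q β : ℝ} (hq : 0 < q) (hβ : 0 < β) :
    ∃ C : ℝ, 0 < C ∧ ∀ v : Vel d,
      (1 + ‖v‖) ^ 2 * (1 + ‖v‖ ^ q) * Real.exp (-β * ‖v‖ ^ 2) ≤ C := by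
  refine ⟨2 * 2 ^ (q + 2) * (1 + ((q + 2) / 2 / β) ^ ((q + 2) / 2)), by positivity, fun v => ?_⟩
  have hv := norm_nonneg v
  have h1 : 1 + ‖v‖ ^ q ≤ 2 * (1 + ‖v‖) ^ q := by
    have h2 : 1 ≤ (1 + ‖v‖) ^ q := Real.one_le_rpow (by linarith) hq.le
    have h3 : ‖v‖ ^ q ≤ (1 + ‖v‖) ^ q := Real.rpow_le_rpow hv (by linarith) hq.le
    linarith
  have h2 : (1 + ‖v‖) ^ 2 * (1 + ‖v‖ ^ q) ≤ 2 * (2 ^ (q + 2) * (1 + ‖v‖ ^ (q + 2))) := by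
    calc (1 + ‖v‖) ^ 2 * (1 + ‖v‖ ^ q) ≤ (1 + ‖v‖) ^ 2 * (2 * (1 + ‖v‖) ^ q) := by gcongr
      _ = 2 * (1 + ‖v‖) ^ (q + 2) := by
        rw [Real.rpow_add (by positivity) q 2, Real.rpow_two]; ring
      _ ≤ _ := by gcongr; exact one_add_rpow_le (by linarith) hv
  have h3 := rpow_mul_exp_neg_sq_le (by linarith : 0 < q + 2) hβ hv
  have h4 : Real.exp (-β * ‖v‖ ^ 2) ≤ 1 := Real.exp_le_one_iff.2 (by
    rw [neg_mul]; exact neg_nonpos.2 (by positivity))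
  calc (1 + ‖v‖) ^ 2 * (1 + ‖v‖ ^ q) * Real.exp (-β * ‖v‖ ^ 2)
      ≤ 2 * (2 ^ (q + 2) * (1 + ‖v‖ ^ (q + 2))) * Real.exp (-β * ‖v‖ ^ 2) := by gcongr
    _ = 2 * 2 ^ (q + 2) * (Real.exp (-β * ‖v‖ ^ 2) +
        ‖v‖ ^ (q + 2) * Real.exp (-β * ‖v‖ ^ 2)) := by ring
    _ ≤ _ := by gcongr

/-- Minus the logarithm of the Maxwellian. -/
def maxwellianExponent (u : Vel d) (T : ℝ) (v : Vel d) : ℝ :=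
  d / 2 * Real.log (2 * Real.pi * T) + ‖v - u‖ ^ 2 / (2 * T)

lemma maxwellian_eq_exp {u : Vel d} {T : ℝ} (hT : 0 < T) (v : Vel d) :
    maxwellian u T v = Real.exp (-maxwellianExponent u T v) := by
  rw [maxwellian, maxwellianExponent, neg_add, Real.exp_add, Real.exp_neg, one_div,
    Real.rpow_def_of_pos (by positivity), mul_comm (d / 2 : ℝ), neg_div]

/-- From 1 + x ≤ e^x with x = a - b. It turns a Lipschitz bound on the exponent into one on the
Maxwellian while keeping Gaussian decay. -/
lemma abs_exp_neg_sub_le (a b : ℝ) :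
    |Real.exp (-a) - Real.exp (-b)| ≤ |a - b| * (Real.exp (-a) + Real.exp (-b)) := by
  wlog hab : a ≤ b generalizing a b
  · rw [abs_sub_comm, abs_sub_comm a, add_comm]; exact this b a (by linarith)
  have h1 : Real.exp (-b) ≤ Real.exp (-a) := Real.exp_le_exp.2 (by linarith)
  rw [abs_of_nonneg (by linarith), abs_of_nonpos (by linarith)]
  have h2 : Real.exp (-b) = Real.exp (-a) * Real.exp (a - b) := by
    rw [← Real.exp_add]; congr 1; ring
  have h3 := Real.add_one_le_exp (a - b)
  have h4 := Real.exp_pos (-a)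
  have h5 := Real.exp_pos (-b)
  nlinarith

lemma abs_log_sub_log_le {T₀ S T : ℝ} (h0 : 0 < T₀) (hS : T₀ ≤ S) (hT : T₀ ≤ T) :
    |Real.log S - Real.log T| ≤ |S - T| / T₀ := by
  wlog hST : T ≤ S generalizing S T
  · rw [abs_sub_comm, abs_sub_comm S]; exact this hT hS (by linarith)
  have hT' := h0.trans_le hT
  have hS' := h0.trans_le hS
  rw [abs_of_nonneg (sub_nonneg.2 (Real.log_le_log hT' hST)), abs_of_nonneg (by linarith),
    ← Real.log_div hS'.ne' hT'.ne']
  calc Real.log (S / T) ≤ S / T - 1 := Real.log_le_sub_one_of_pos (by positivity)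
    _ = (S - T) / T := by field_simp
    _ ≤ (S - T) / T₀ := by gcongr

/-- Three changes in turn: T in the logarithm, T in the quadratic term, then u. -/
lemma maxwellianExponent_sub_le {U T₀ : ℝ} (h0 : 0 < T₀) {u u' v : Vel d} {T T' : ℝ}
    (hu : ‖u‖ ≤ U) (hu' : ‖u'‖ ≤ U) (hT : T₀ ≤ T) (hT' : T₀ ≤ T') :
    |maxwellianExponent u T v - maxwellianExponent u' T' v| ≤
      (d / 2 / T₀ + (1 + U) ^ 2 / T₀ ^ 2 + (1 + U) / T₀) * (1 + ‖v‖) ^ 2 *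
        (‖u - u'‖ + |T - T'|) := by
  have hv := norm_nonneg v
  have hU : 0 ≤ U := (norm_nonneg u).trans hu
  have hT0 := h0.trans_le hT
  have hT0' := h0.trans_le hT'
  have hpi := Real.pi_pos
  have h1 : |Real.log (2 * Real.pi * T) - Real.log (2 * Real.pi * T')| ≤ |T - T'| / T₀ := by
    rw [Real.log_mul (by positivity) hT0.ne', Real.log_mul (by positivity) hT0'.ne',
      add_sub_add_left_eq_sub]
    exact abs_log_sub_log_le h0 hT hT'
  have hvu : ‖v - u‖ ≤ (1 + U) * (1 + ‖v‖) := (norm_sub_le _ _).trans (by nlinarith)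
  have hvu' : ‖v - u'‖ ≤ (1 + U) * (1 + ‖v‖) := (norm_sub_le _ _).trans (by nlinarith)
  have h2 : |‖v - u‖ ^ 2 / (2 * T) - ‖v - u‖ ^ 2 / (2 * T')| ≤
      (1 + U) ^ 2 / T₀ ^ 2 * (1 + ‖v‖) ^ 2 * |T - T'| := by
    have e : ‖v - u‖ ^ 2 / (2 * T) - ‖v - u‖ ^ 2 / (2 * T') =
        ‖v - u‖ ^ 2 * (T' - T) / (2 * (T * T')) := by field_simp
    rw [e, abs_div, abs_mul, abs_of_nonneg (by positivity : 0 ≤ ‖v - u‖ ^ 2),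
      abs_of_nonneg (by positivity : 0 ≤ 2 * (T * T')), abs_sub_comm T']
    have h3 : T₀ ^ 2 ≤ 2 * (T * T') := by nlinarith
    calc ‖v - u‖ ^ 2 * |T - T'| / (2 * (T * T'))
        ≤ ((1 + U) * (1 + ‖v‖)) ^ 2 * |T - T'| / T₀ ^ 2 := by gcongr
      _ = _ := by ring
  have h3 : |‖v - u‖ ^ 2 / (2 * T') - ‖v - u'‖ ^ 2 / (2 * T')| ≤
      (1 + U) / T₀ * (1 + ‖v‖) ^ 2 * ‖u - u'‖ := by
    have e : ‖v - u‖ ^ 2 / (2 * T') - ‖v - u'‖ ^ 2 / (2 * T') =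
        (‖v - u‖ + ‖v - u'‖) * (‖v - u‖ - ‖v - u'‖) / (2 * T') := by ring
    have h4 : |‖v - u‖ - ‖v - u'‖| ≤ ‖u - u'‖ := by
      refine (abs_norm_sub_norm_le _ _).trans_eq ?_
      rw [sub_sub_sub_cancel_left, norm_sub_rev]
    rw [e, abs_div, abs_mul, abs_of_nonneg (by positivity : 0 ≤ ‖v - u‖ + ‖v - u'‖),
      abs_of_nonneg (by positivity : 0 ≤ 2 * T')]
    calc (‖v - u‖ + ‖v - u'‖) * |‖v - u‖ - ‖v - u'‖| / (2 * T')
        ≤ (2 * ((1 + U) * (1 + ‖v‖))) * ‖u - u'‖ / (2 * T₀) := by gcongr; linarith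
      _ = (1 + U) / T₀ * (1 + ‖v‖) * ‖u - u'‖ := by field_simp
      _ ≤ _ := by gcongr; nlinarith
  have h4 : (1 : ℝ) ≤ (1 + ‖v‖) ^ 2 := by nlinarith
  have h5 : |d / 2 * Real.log (2 * Real.pi * T) - d / 2 * Real.log (2 * Real.pi * T')| ≤
      d / 2 / T₀ * (1 + ‖v‖) ^ 2 * |T - T'| := by
    rw [← mul_sub, abs_mul, abs_of_nonneg (by positivity : (0 : ℝ) ≤ d / 2)]
    calc (d / 2 : ℝ) * _ ≤ d / 2 * (|T - T'| / T₀) := by gcongr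
      _ = d / 2 / T₀ * 1 * |T - T'| := by ring
      _ ≤ _ := by gcongr
  have h6 : maxwellianExponent u T v - maxwellianExponent u' T' v =
      (d / 2 * Real.log (2 * Real.pi * T) - d / 2 * Real.log (2 * Real.pi * T')) +
      (‖v - u‖ ^ 2 / (2 * T) - ‖v - u‖ ^ 2 / (2 * T')) +
      (‖v - u‖ ^ 2 / (2 * T') - ‖v - u'‖ ^ 2 / (2 * T')) := by
    rw [maxwellianExponent, maxwellianExponent]; ring
  rw [h6]
  refine (abs_add_three _ _ _).trans ((add_le_add (add_le_add h5 h2) h3).trans ?_)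
  have p1 : 0 ≤ d / 2 / T₀ * (1 + ‖v‖) ^ 2 * ‖u - u'‖ := by positivity
  have p2 : 0 ≤ (1 + U) ^ 2 / T₀ ^ 2 * (1 + ‖v‖) ^ 2 * ‖u - u'‖ := by positivity
  have p3 : 0 ≤ (1 + U) / T₀ * (1 + ‖v‖) ^ 2 * |T - T'| := by positivity
  linarith

/-- From |v|² ≤ 2|v-u|² + 2U²: a single centred Gaussian dominates the whole range of moments. -/
lemma maxwellian_le {U T₀ T₁ : ℝ} (h0 : 0 < T₀) {u : Vel d} {T : ℝ}
    (hu : ‖u‖ ≤ U) (hT : T₀ ≤ T) (hT1 : T ≤ T₁) (v : Vel d) :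
    maxwellian u T v ≤ 1 / (2 * Real.pi * T₀) ^ ((d : ℝ) / 2) * Real.exp (U ^ 2 / (2 * T₁)) *
      Real.exp (-(1 / (4 * T₁)) * ‖v‖ ^ 2) := by
  have hT0 := h0.trans_le hT
  have hT10 := hT0.trans_le hT1
  have hpi := Real.pi_pos
  have h1 : -‖v - u‖ ^ 2 / (2 * T) ≤ U ^ 2 / (2 * T₁) + -(1 / (4 * T₁)) * ‖v‖ ^ 2 := by
    have h2 : ‖v - u‖ ^ 2 / (2 * T₁) ≤ ‖v - u‖ ^ 2 / (2 * T) := by gcongr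
    have h3 : ‖v‖ ^ 2 ≤ 2 * ‖v - u‖ ^ 2 + 2 * U ^ 2 := by
      have h4 : ‖v‖ ≤ ‖v - u‖ + U := by
        have := norm_add_le (v - u) u
        rw [sub_add_cancel] at this; linarith
      have h5 : ‖v‖ ^ 2 ≤ (‖v - u‖ + U) ^ 2 := by gcongr
      nlinarith [sq_nonneg (‖v - u‖ - U)]
    have h6 : ‖v‖ ^ 2 / (4 * T₁) ≤ (2 * ‖v - u‖ ^ 2 + 2 * U ^ 2) / (4 * T₁) := by gcongr
    have h7 : (2 * ‖v - u‖ ^ 2 + 2 * U ^ 2) / (4 * T₁) =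
      ‖v - u‖ ^ 2 / (2 * T₁) + U ^ 2 / (2 * T₁) := by field_simp; ring
    have h8 : -(1 / (4 * T₁)) * ‖v‖ ^ 2 = -(‖v‖ ^ 2 / (4 * T₁)) := by ring
    rw [neg_div, h8]; linarith
  rw [maxwellian, mul_assoc _ (Real.exp _) (Real.exp _), ← Real.exp_add]
  gcongr

/-- On a bounded set of moments, with temperature bounded away from zero, the Maxwellian is
Lipschitz in its moments with respect to the weighted sup norm. -/
lemma exists_maxwellian_lipschitz {q R U T₀ T₁ : ℝ} (hq : 0 < q) (h0 : 0 < T₀) (h01 : T₀ ≤ T₁)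
    (hR : 0 ≤ R) :
    ∃ C : ℝ, 0 < C ∧
      (∀ (ρ : ℝ) (u : Vel d) (T : ℝ), 0 ≤ ρ → ρ ≤ R → ‖u‖ ≤ U → T₀ ≤ T → T ≤ T₁ → ∀ v,
        ρ * maxwellian u T v * (1 + ‖v‖ ^ q) ≤ C) ∧
      ∀ (ρ ρ' : ℝ) (u u' : Vel d) (T T' : ℝ), 0 ≤ ρ → ρ ≤ R → 0 ≤ ρ' → ρ' ≤ R →
        ‖u‖ ≤ U → ‖u'‖ ≤ U → T₀ ≤ T → T ≤ T₁ → T₀ ≤ T' → T' ≤ T₁ → ∀ v,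
        |ρ * maxwellian u T v - ρ' * maxwellian u' T' v| * (1 + ‖v‖ ^ q) ≤
          C * (|ρ - ρ'| + ‖u - u'‖ + |T - T'|) := by
  have h10 : 0 < T₁ := h0.trans_le h01
  obtain ⟨C₁, hC₁, hg⟩ := exists_weight_mul_gaussian_le (d := d) (β := 1 / (4 * T₁)) hq
    (by positivity)
  set K := 1 / (2 * Real.pi * T₀) ^ ((d : ℝ) / 2) * Real.exp (U ^ 2 / (2 * T₁)) with hK
  have hpi := Real.pi_pos
  have hK0 : 0 < K := by positivity
  -- The sign of U is not prescribed; the absolute value makes L nonnegative in any case.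
  set L := |d / 2 / T₀ + (1 + U) ^ 2 / T₀ ^ 2 + (1 + U) / T₀| with hL
  have hL0 : 0 ≤ L := abs_nonneg _
  have hM : ∀ (u : Vel d) (T : ℝ), ‖u‖ ≤ U → T₀ ≤ T → T ≤ T₁ → ∀ v,
      (1 + ‖v‖) ^ 2 * (1 + ‖v‖ ^ q) * maxwellian u T v ≤ K * C₁ := fun u T hu hT hT1 v => by
    have h1 := maxwellian_le h0 hu hT hT1 v
    have hw := weight_pos q v
    calc (1 + ‖v‖) ^ 2 * (1 + ‖v‖ ^ q) * maxwellian u T v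
        ≤ (1 + ‖v‖) ^ 2 * (1 + ‖v‖ ^ q) * (K * Real.exp (-(1 / (4 * T₁)) * ‖v‖ ^ 2)) := by gcongr
      _ = K * ((1 + ‖v‖) ^ 2 * (1 + ‖v‖ ^ q) * Real.exp (-(1 / (4 * T₁)) * ‖v‖ ^ 2)) := by ring
      _ ≤ K * C₁ := by gcongr; exact hg v
  have hM1 : ∀ (u : Vel d) (T : ℝ), ‖u‖ ≤ U → T₀ ≤ T → T ≤ T₁ → ∀ v,
      maxwellian u T v * (1 + ‖v‖ ^ q) ≤ K * C₁ := fun u T hu hT hT1 v => by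
    refine le_trans ?_ (hM u T hu hT hT1 v)
    have h1 : (1 : ℝ) ≤ (1 + ‖v‖) ^ 2 := by nlinarith [norm_nonneg v]
    have h2 := mul_nonneg (weight_pos q v).le (maxwellian_nonneg (u := u) (h0.le.trans hT) v)
    nlinarith
  refine ⟨K * C₁ * (1 + R + 2 * R * L), by positivity, ?_, ?_⟩
  · intro ρ u T hρ hρR hu hT hT1 v
    have h2 := hM1 u T hu hT hT1 v
    have h3 := mul_nonneg (maxwellian_nonneg (u := u) (h0.le.trans hT) v) (weight_pos q v).le
    calc ρ * maxwellian u T v * (1 + ‖v‖ ^ q) = ρ * (maxwellian u T v * (1 + ‖v‖ ^ q)) := by ring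
      _ ≤ R * (K * C₁) := by gcongr
      _ ≤ K * C₁ * (1 + R + 2 * R * L) := by
        have : 0 ≤ K * C₁ * (1 + 2 * R * L) := by positivity
        linarith
  · intro ρ ρ' u u' T T' hρ hρR hρ' hρR' hu hu' hT hT1 hT' hT1' v
    have hw := weight_pos q v
    set M := maxwellian u T v with hMdef
    set M' := maxwellian u' T' v with hMdef'
    have hM0 : 0 ≤ M := maxwellian_nonneg (h0.le.trans hT) v
    have hM0' : 0 ≤ M' := maxwellian_nonneg (h0.le.trans hT') v
    have h1 : |M - M'| * (1 + ‖v‖ ^ q) ≤ 2 * L * (K * C₁) * (‖u - u'‖ + |T - T'|) := by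
      have h2 := abs_exp_neg_sub_le (maxwellianExponent u T v) (maxwellianExponent u' T' v)
      rw [← maxwellian_eq_exp (h0.trans_le hT), ← maxwellian_eq_exp (h0.trans_le hT')] at h2
      have h3 : |maxwellianExponent u T v - maxwellianExponent u' T' v| ≤
          L * (1 + ‖v‖) ^ 2 * (‖u - u'‖ + |T - T'|) :=
        (maxwellianExponent_sub_le h0 hu hu' hT hT').trans (by
          gcongr; exact le_abs_self _)
      have h4 := hM u T hu hT hT1 v
      have h5 := hM u' T' hu' hT' hT1' v
      calc |M - M'| * (1 + ‖v‖ ^ q)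
          ≤ (L * (1 + ‖v‖) ^ 2 * (‖u - u'‖ + |T - T'|)) * (M + M') * (1 + ‖v‖ ^ q) := by
            gcongr
            exact h2.trans (by gcongr)
        _ = L * (‖u - u'‖ + |T - T'|) * ((1 + ‖v‖) ^ 2 * (1 + ‖v‖ ^ q) * M +
            (1 + ‖v‖) ^ 2 * (1 + ‖v‖ ^ q) * M') := by ring
        _ ≤ L * (‖u - u'‖ + |T - T'|) * (K * C₁ + K * C₁) := by gcongr
        _ = _ := by ring
    have h2 : |ρ * M - ρ' * M'| ≤ |ρ - ρ'| * M + R * |M - M'| := by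
      have e : ρ * M - ρ' * M' = (ρ - ρ') * M + ρ' * (M - M') := by ring
      rw [e]
      refine (abs_add_le _ _).trans ?_
      rw [abs_mul, abs_mul, abs_of_nonneg hM0, abs_of_nonneg hρ']
      gcongr
    have h3 := hM1 u T hu hT hT1 v
    calc |ρ * M - ρ' * M'| * (1 + ‖v‖ ^ q)
        ≤ (|ρ - ρ'| * M + R * |M - M'|) * (1 + ‖v‖ ^ q) := by gcongr
      _ = |ρ - ρ'| * (M * (1 + ‖v‖ ^ q)) + R * (|M - M'| * (1 + ‖v‖ ^ q)) := by ring
      _ ≤ |ρ - ρ'| * (K * C₁) + R * (2 * L * (K * C₁) * (‖u - u'‖ + |T - T'|)) := by gcongr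
      _ ≤ K * C₁ * (1 + R + 2 * R * L) * (|ρ - ρ'| + ‖u - u'‖ + |T - T'|) := by
        have p1 : 0 ≤ K * C₁ * (1 + R) * (‖u - u'‖ + |T - T'|) := by positivity
        have p2 : 0 ≤ K * C₁ * (R + 2 * R * L) * |ρ - ρ'| := by positivity
        linarith

/-! ### Bounds on the moments and Lipschitz dependence on the density -/

namespace WeightBounded

variable {q N : ℝ} {h : Vel d → ℝ}

lemma mass_le_weightIntegral (H : WeightBounded q N h) (hq : (d : ℝ) + 2 < q) :
    mass h ≤ N * weightIntegral d q := by
  have h1 := (integrable_smul_of_bound (B := 1) hq H.measurable H.abs_bound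
    (F := fun _ => (1 : ℝ)) aestronglyMeasurable_const (fun v => by simp)).2
  simp only [smul_eq_mul, mul_one] at h1
  exact (Real.le_norm_self _).trans h1

lemma norm_mean_le (H : WeightBounded q N h) (hq : (d : ℝ) + 2 < q) {c : ℝ} (hc : 0 < c)
    (hρ : c ≤ mass h) : ‖mean h‖ ≤ N * weightIntegral d q / c := by
  have h1 := (integrable_smul_of_bound (B := 1) hq H.measurable H.abs_bound
    (F := fun v => v) measurable_id.aestronglyMeasurable
    (fun v => by nlinarith [sq_nonneg (‖v‖ - 1)])).2
  have h0 := hc.trans_le hρ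
  rw [mul_one, ← mass_smul_mean h0, norm_smul, Real.norm_of_nonneg h0.le] at h1
  rw [le_div_iff₀ hc]
  nlinarith [norm_nonneg (mean h)]

lemma temp_le (H : WeightBounded q N h) (hd : 1 ≤ d) (hq : (d : ℝ) + 2 < q) {c : ℝ} (hc : 0 < c)
    (hρ : c ≤ mass h) : temp h ≤ N * weightIntegral d q / c := by
  have h1 := (integrable_smul_of_bound (B := 1) hq H.measurable H.abs_bound
    (F := fun v => ‖v‖ ^ 2) (by fun_prop) (fun v => by simp)).2
  have h0 := hc.trans_le hρ
  have hd1 : (1 : ℝ) ≤ d := by exact_mod_cast hd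
  simp only [smul_eq_mul, mul_one] at h1
  have h2 := (Real.le_norm_self _).trans h1
  rw [H.integral_sq hq hd h0] at h2
  have hT := H.temp_nonneg
  rw [le_div_iff₀ hc]
  calc temp h * c ≤ temp h * mass h := by gcongr
    _ ≤ mass h * (d * temp h + ‖mean h‖ ^ 2) := by
      have : temp h ≤ d * temp h := le_mul_of_one_le_left hT hd1
      nlinarith [sq_nonneg ‖mean h‖]
    _ ≤ _ := h2

end WeightBounded

lemma exists_moment_bounds (hd : 1 ≤ d) {q N c : ℝ} (hq : (d : ℝ) + 2 < q) (hN : 0 ≤ N)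
    (hc : 0 < c) :
    ∃ R U T₀ T₁ : ℝ, 0 ≤ R ∧ 0 ≤ U ∧ 0 < T₀ ∧ T₀ ≤ T₁ ∧ ∀ h : Vel d → ℝ, WeightBounded q N h →
      c ≤ mass h → mass h ≤ R ∧ ‖mean h‖ ≤ U ∧ T₀ ≤ temp h ∧ temp h ≤ T₁ := by
  obtain ⟨T₀, h0, hT⟩ := exists_temp_lower hd hq hN hc
  have hI := weightIntegral_nonneg d q
  exact ⟨N * weightIntegral d q, N * weightIntegral d q / c, T₀,
    max T₀ (N * weightIntegral d q / c), by positivity, by positivity, h0, le_max_left _ _,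
    fun h H hρ => ⟨H.mass_le_weightIntegral hq, H.norm_mean_le hq hc hρ, hT h H hρ,
      (H.temp_le hd hq hc hρ).trans (le_max_right _ _)⟩⟩

/-- Bounded moments give uniform Gaussian tails, so a bound in the weight q yields one in any other
weight r. This transfers the exponent that comes with a solution to the chosen one. -/
lemma exists_localGain_bound (hd : 1 ≤ d) {q r N c : ℝ} (hq : (d : ℝ) + 2 < q) (hr : 0 < r)
    (hN : 0 ≤ N) (hc : 0 < c) :
    ∃ C : ℝ, 0 < C ∧ ∀ h : Vel d → ℝ, WeightBounded q N h → c ≤ mass h →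
      ∀ v, localGain h v * (1 + ‖v‖ ^ r) ≤ C := by
  obtain ⟨R, U, T₀, T₁, hR, -, h0, h01, hm⟩ := exists_moment_bounds hd hq hN hc
  obtain ⟨C, hC, hb, -⟩ := exists_maxwellian_lipschitz (d := d) (U := U) hr h0 h01 hR
  refine ⟨C, hC, fun h H hρ v => ?_⟩
  obtain ⟨h1, h2, h3, h4⟩ := hm h H hρ
  exact hb _ _ _ H.mass_nonneg h1 h2 h3 h4 v

/-- Lipschitz dependence of the gain term on the distribution function, in the weighted sup norm. -/
theorem exists_localGain_lipschitz (hd : 1 ≤ d) {q N c : ℝ} (hq : (d : ℝ) + 2 < q)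
    (hN : 0 ≤ N) (hc : 0 < c) :
    ∃ C : ℝ, 0 < C ∧ ∀ (h h' : Vel d → ℝ) (δ : ℝ), WeightBounded q N h → WeightBounded q N h' →
      c ≤ mass h → c ≤ mass h' → (∀ v, |h v - h' v| * (1 + ‖v‖ ^ q) ≤ δ) →
      ∀ v, |localGain h v - localGain h' v| * (1 + ‖v‖ ^ q) ≤ C * δ := by
  obtain ⟨R, U, T₀, T₁, hR, hU, h0, h01, hm⟩ := exists_moment_bounds hd hq hN hc
  have hd1 : (1 : ℝ) ≤ d := by exact_mod_cast hd
  have hq0 : 0 < q := by linarith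
  obtain ⟨C, hC, -, hb⟩ := exists_maxwellian_lipschitz (d := d) (U := U) hq0 h0 h01 hR
  have hI := weightIntegral_nonneg d q
  set I := weightIntegral d q
  have hT1 : 0 < T₁ := h0.trans_le h01
  set A := I + I * U with hA
  set B := I + I * (d * T₁ + U ^ 2) with hB
  have hA0 : 0 ≤ A := by positivity
  have hB0 : 0 ≤ B := by positivity
  refine ⟨C * (I + A / c + (B / c + 2 * U * (A / c))) + 1, by positivity,
    fun h h' δ H H' hρ hρ' hδ v => ?_⟩
  obtain ⟨r1, u1, t0, t1⟩ := hm h H hρ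
  obtain ⟨r1', u1', t0', t1'⟩ := hm h' H' hρ'
  have hρ0 := hc.trans_le hρ
  have hρ0' := hc.trans_le hρ'
  have hδ0 : 0 ≤ δ := (mul_nonneg (abs_nonneg _) (weight_pos q 0).le).trans (hδ 0)
  have hsub : Measurable fun v => h v - h' v := H.measurable.sub H'.measurable
  -- Mass, momentum and energy are linear in h, so their variations are controlled directly; mean
  -- and temperature follow by division by the mass.
  have d0 : |mass h - mass h'| ≤ δ * I := by
    have h1 := (integrable_smul_of_bound (B := 1) hq hsub hδ
      (F := fun _ => (1 : ℝ)) aestronglyMeasurable_const (fun v => by simp)).2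
    simp only [smul_eq_mul, mul_one] at h1
    rwa [integral_sub (H.integrable hq) (H'.integrable hq)] at h1
  have d1 : ‖mass h • mean h - mass h' • mean h'‖ ≤ δ * I := by
    have h1 := (integrable_smul_of_bound (B := 1) hq hsub hδ
      (F := fun v => v) measurable_id.aestronglyMeasurable
      (fun v => by nlinarith [sq_nonneg (‖v‖ - 1)])).2
    simp only [sub_smul, mul_one] at h1
    rwa [integral_sub (H.integrable_smul_id hq) (H'.integrable_smul_id hq),
      ← WeightBounded.mass_smul_mean hρ0, ← WeightBounded.mass_smul_mean hρ0'] at h1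
  have d2 : |mass h * (d * temp h + ‖mean h‖ ^ 2) - mass h' * (d * temp h' + ‖mean h'‖ ^ 2)|
      ≤ δ * I := by
    have h1 := (integrable_smul_of_bound (B := 1) hq hsub hδ
      (F := fun v => ‖v‖ ^ 2) (by fun_prop) (fun v => by simp)).2
    simp only [smul_eq_mul, sub_mul, mul_one] at h1
    rwa [integral_sub (H.integrable_mul_sq hq) (H'.integrable_mul_sq hq),
      H.integral_sq hq hd hρ0, H'.integral_sq hq hd hρ0'] at h1
  have e1 : ‖mean h - mean h'‖ ≤ A / c * δ := by
    have h1 : mass h • (mean h - mean h') =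
        (mass h • mean h - mass h' • mean h') - (mass h - mass h') • mean h' := by
      module
    have h2 : mass h * ‖mean h - mean h'‖ ≤ δ * I + δ * I * U := by
      rw [← Real.norm_of_nonneg hρ0.le, ← norm_smul, h1]
      refine (norm_sub_le _ _).trans (add_le_add d1 ?_)
      rw [norm_smul]
      exact mul_le_mul d0 u1' (norm_nonneg _) (by positivity)
    rw [div_mul_eq_mul_div, le_div_iff₀ hc, hA]
    nlinarith [norm_nonneg (mean h - mean h')]
  have e2 : |temp h - temp h'| ≤ (B / c + 2 * U * (A / c)) * δ := by
    -- The energy per unit mass is compared first, ϱE being linear in h; the temperature is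
    -- recovered by subtracting |u|².
    set E := d * temp h + ‖mean h‖ ^ 2 with hE
    set E' := d * temp h' + ‖mean h'‖ ^ 2 with hE'
    have hT0' : 0 ≤ temp h' := h0.le.trans t0'
    have hE'0 : 0 ≤ E' := by positivity
    have hE'1 : E' ≤ d * T₁ + U ^ 2 := by rw [hE']; gcongr
    have h1 : mass h * (E - E') = (mass h * E - mass h' * E') - (mass h - mass h') * E' := by ring
    have h2 : mass h * |E - E'| ≤ δ * I + δ * I * (d * T₁ + U ^ 2) := by
      rw [← abs_of_pos hρ0, ← abs_mul, h1]
      refine (abs_sub _ _).trans (add_le_add d2 ?_)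
      rw [abs_mul, abs_of_nonneg hE'0]
      exact mul_le_mul d0 hE'1 hE'0 (by positivity)
    have h3 : |E - E'| ≤ B / c * δ := by
      rw [div_mul_eq_mul_div, le_div_iff₀ hc, hB]
      nlinarith [abs_nonneg (E - E')]
    have h4 : |‖mean h‖ ^ 2 - ‖mean h'‖ ^ 2| ≤ 2 * U * (A / c * δ) := by
      have h5 : ‖mean h‖ ^ 2 - ‖mean h'‖ ^ 2 =
        (‖mean h‖ + ‖mean h'‖) * (‖mean h‖ - ‖mean h'‖) := by ring
      rw [h5, abs_mul, abs_of_nonneg (by positivity : 0 ≤ ‖mean h‖ + ‖mean h'‖)]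
      exact mul_le_mul (by linarith) ((abs_norm_sub_norm_le _ _).trans e1) (abs_nonneg _)
        (by positivity)
    have h6 : |(d : ℝ) * (temp h - temp h')| ≤ B / c * δ + 2 * U * (A / c * δ) := by
      have h7 : (d : ℝ) * (temp h - temp h') =
        (E - E') - (‖mean h‖ ^ 2 - ‖mean h'‖ ^ 2) := by rw [hE, hE']; ring
      rw [h7]
      exact (abs_sub _ _).trans (add_le_add h3 h4)
    rw [abs_mul, abs_of_nonneg (by positivity : (0 : ℝ) ≤ d)] at h6
    have h8 : |temp h - temp h'| ≤ d * |temp h - temp h'| :=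
      le_mul_of_one_le_left (abs_nonneg _) hd1
    linarith
  refine (hb _ _ _ _ _ _ H.mass_nonneg r1 H'.mass_nonneg r1' u1 u1' t0 t1 t0' t1' v).trans ?_
  calc C * (|mass h - mass h'| + ‖mean h - mean h'‖ + |temp h - temp h'|)
      ≤ C * (δ * I + A / c * δ + (B / c + 2 * U * (A / c)) * δ) := by gcongr
    _ ≤ _ := by linarith

/-! ### A priori bounds for mild solutions -/

/-- A Gronwall inequality for families of functions of time, without measurability. -/
lemma gronwall_family {ι : Type*} {F : ℝ → ι → ℝ} {τ A C M : ℝ} (hA : 0 ≤ A) (hC : 0 < C)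
    (hM : ∀ s ∈ Icc 0 τ, ∀ i, F s i ≤ M)
    (step : ∀ m, 0 ≤ m → (∀ s ∈ Icc 0 τ, ∀ i, F s i ≤ m * Real.exp (2 * C * s)) →
      ∀ t ∈ Icc 0 τ, ∀ i, F t i ≤ A + ∫ s in (0 : ℝ)..t, C * (m * Real.exp (2 * C * s))) :
    ∀ t ∈ Icc 0 τ, ∀ i, F t i ≤ 2 * A * Real.exp (2 * C * t) := by
  have hexp : ∀ t : ℝ, 0 ≤ t → 1 ≤ Real.exp (2 * C * t) := fun t ht =>
    Real.one_le_exp (by positivity)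
  -- With the weight e^(2Cs), one pass of `step` replaces the constant m by A + m/2. Starting from
  -- 2A + |M|, the excess over the fixed point 2A halves each time.
  have key : ∀ n : ℕ, ∀ s ∈ Icc 0 τ, ∀ i,
      F s i ≤ (2 * A + |M| * (1 / 2) ^ n) * Real.exp (2 * C * s) := by
    intro n
    induction n with
    | zero =>
      intro s hs i
      have h1 := hexp s hs.1
      have h2 := (hM s hs i).trans (le_abs_self M)
      have h3 : |M| * 1 ≤ |M| * Real.exp (2 * C * s) := by gcongr
      have h4 : 0 ≤ 2 * A * Real.exp (2 * C * s) := by positivity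
      rw [pow_zero]
      linarith
    | succ n ih =>
      intro t ht i
      refine (step _ (by positivity) ih t ht i).trans ?_
      have h1 : ∫ s in (0 : ℝ)..t, Real.exp (2 * C * s) =
          (2 * C)⁻¹ * (Real.exp (2 * C * t) - 1) := by
        rw [intervalIntegral.integral_comp_mul_left (fun x => Real.exp x) (by positivity),
          integral_exp]
        simp
      rw [intervalIntegral.integral_const_mul, intervalIntegral.integral_const_mul, h1]
      set m := 2 * A + |M| * (1 / 2) ^ n with hm
      have hm0 : 0 ≤ m := by positivity
      have h2 : C * (m * ((2 * C)⁻¹ * (Real.exp (2 * C * t) - 1))) =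
          m / 2 * (Real.exp (2 * C * t) - 1) := by field_simp
      have h3 : 2 * A + |M| * (1 / 2) ^ (n + 1) = A + m / 2 := by rw [hm, pow_succ]; ring
      rw [h2, h3]
      have h4 := hexp t ht.1
      nlinarith
  intro t ht i
  have hlim : Filter.Tendsto (fun n : ℕ => (2 * A + |M| * (1 / 2) ^ n) * Real.exp (2 * C * t))
      Filter.atTop (nhds ((2 * A + |M| * 0) * Real.exp (2 * C * t))) :=
    (((tendsto_pow_atTop_nhds_zero_of_lt_one (by norm_num) (by norm_num)).const_mul _).const_add
      _).mul_const _
  rw [mul_zero, add_zero] at hlim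
  exact ge_of_tendsto' hlim fun n => key n t ht i

/-! ### Averaged gains and Duhamel estimates -/

/-- `h` is measurable, nonnegative and `h(x,v) (1 + |v|^q) ≤ N`. -/
structure PhaseBounded (q N : ℝ) (h : PhaseFun d) : Prop where
  measurable : Measurable fun p : Torus d × Vel d => h p.1 p.2
  nonneg : ∀ x v, 0 ≤ h x v
  bound : ∀ x v, h x v * (1 + ‖v‖ ^ q) ≤ N

lemma PhaseBounded.weightBounded {q N : ℝ} {h : PhaseFun d} (H : PhaseBounded q N h)
    (x : Torus d) : WeightBounded q N (h x) :=
  ⟨H.measurable.comp measurable_prodMk_left, H.nonneg x, H.bound x⟩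

/-- A spatial averaging operator on phase-space functions. -/
structure IsAveraging (S : PhaseFun d → PhaseFun d) : Prop where
  weightBounded : ∀ {q N : ℝ} {h : PhaseFun d}, (d : ℝ) + 2 < q → PhaseBounded q N h →
    ∀ x, WeightBounded q N (S h x)
  lower : ∀ {q N : ℝ} {h : PhaseFun d} {b : Vel d → ℝ}, PhaseBounded q N h →
    (∀ x v, b v ≤ h x v) → ∀ x v, b v ≤ S h x v

/-- The gain operator `G` is the Maxwellian with the moments of the average `S`. -/
structure IsAveragedGain (G S : PhaseFun d → PhaseFun d) : Prop extends IsAveraging S where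
  gain_eq : ∀ {q N : ℝ} {h : PhaseFun d}, (d : ℝ) + 2 < q → PhaseBounded q N h →
    ∀ x v, G h x v = localGain (S h x) v

lemma isAveragedGain_gain : IsAveragedGain (gain (d := d)) id where
  weightBounded _ H x := H.weightBounded x
  lower _ hb := hb
  gain_eq _ _ _ _ := rfl

namespace IsMildSolution

variable {G G' : PhaseFun d → PhaseFun d} {f₀ : PhaseFun d} {f g : ℝ → PhaseFun d}

lemma measurable_at (H : IsMildSolution G f₀ f) {t : ℝ} (ht : 0 ≤ t) :
    Measurable fun p : Torus d × Vel d => f t p.1 p.2 := by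
  have h1 : Measurable fun p : Torus d × Vel d => ((⟨t, ht⟩ : ℝ≥0), p) := measurable_prodMk_left
  exact H.measurable.comp h1

/-- The exponent is the solution's own and the bound is not uniform; it only serves to start the
argument in `exists_apriori_bounds`. -/
lemma exists_phaseBounded (H : IsMildSolution G f₀ f) {τ : ℝ} (hτ : 0 < τ) :
    ∃ q N : ℝ, (d : ℝ) + 2 < q ∧ ∀ t ∈ Icc 0 τ, PhaseBounded q N (f t) := by
  obtain ⟨q, hq, hb⟩ := H.bounded
  refine ⟨q, (⨆ t ∈ Icc (0 : ℝ) τ, weightedSup q (f t)).toReal, hq, fun t ht =>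
    ⟨H.measurable_at ht.1, H.nonneg t ht.1, fun x v => ?_⟩⟩
  rw [← ENNReal.ofReal_le_iff_le_toReal (hb τ hτ).ne]
  refine le_trans ?_ (le_biSup (fun t => weightedSup q (f t)) ht)
  exact le_iSup₂ (f := fun x v => ENNReal.ofReal (f t x v * (1 + ‖v‖ ^ q))) x v

/-- Duhamel estimate for one solution. -/
lemma le_of_gain_le (H : IsMildSolution G f₀ f) {t w D : ℝ} (ht : 0 ≤ t) (hw : 0 ≤ w) {v : Vel d}
    (hf₀ : ∀ x, 0 ≤ f₀ x v) (h0 : ∀ x, f₀ x v * w ≤ D) {β : ℝ → ℝ} (hβc : Continuous β)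
    (hβ : ∀ s ∈ Icc 0 t, ∀ x, |G (f s) x v| * w ≤ β s) (x : Torus d) :
    f t x v * w ≤ D + ∫ s in (0 : ℝ)..t, β s := by
  rw [H.duhamel t ht x v, add_mul]
  refine add_le_add ?_ ?_
  · refine le_trans ?_ (h0 (x - proj (t • v)))
    gcongr
    exact mul_le_of_le_one_left (hf₀ _) (Real.exp_le_one_iff.2 (by linarith))
  · rw [← intervalIntegral.integral_mul_const]
    refine (Real.le_norm_self _).trans (intervalIntegral.norm_integral_le_of_norm_le ht
      (.of_forall fun s hs => ?_) (hβc.intervalIntegrable _ _))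
    rw [norm_mul, norm_mul, Real.norm_of_nonneg hw, Real.norm_of_nonneg (Real.exp_pos _).le,
      mul_assoc]
    refine le_trans ?_ (hβ s ⟨hs.1.le, hs.2⟩ (x - proj ((t - s) • v)))
    exact mul_le_of_le_one_left (by positivity) (Real.exp_le_one_iff.2 (by linarith [hs.2]))

/-- Duhamel estimate for the difference of two solutions, up to a translation. -/
lemma abs_sub_le_of_gain_sub_le (H : IsMildSolution G f₀ f) (H' : IsMildSolution G' f₀ g)
    {t w D : ℝ} (ht : 0 ≤ t) (hw : 0 ≤ w) {v : Vel d} {z : Torus d}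
    (h0 : ∀ x, |f₀ (x + z) v - f₀ x v| * w ≤ D) {β : ℝ → ℝ} (hβc : Continuous β)
    (hβ : ∀ s ∈ Icc 0 t, ∀ x, |G (f s) (x + z) v - G' (g s) x v| * w ≤ β s) (x : Torus d) :
    |f t (x + z) v - g t x v| * w ≤ D + ∫ s in (0 : ℝ)..t, β s := by
  rw [H.duhamel t ht (x + z) v, H'.duhamel t ht x v]
  -- Translation in x commutes with free transport, so both Duhamel formulas run along the same
  -- characteristic up to z.
  have h1 : ∀ y : Torus d, x + z - y = x - y + z := fun y => by abel
  rw [add_sub_add_comm, ← mul_sub, ← intervalIntegral.integral_sub (H.integrable t ht (x + z) v)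
    (H'.integrable t ht x v)]
  simp_rw [← mul_sub, h1]
  refine (mul_le_mul_of_nonneg_right (abs_add_le _ _) hw).trans ?_
  rw [add_mul]
  refine add_le_add ?_ ?_
  · refine le_trans ?_ (h0 (x - proj (t • v)))
    rw [abs_mul, Real.abs_exp]
    gcongr
    exact mul_le_of_le_one_left (abs_nonneg _) (Real.exp_le_one_iff.2 (by linarith))
  · rw [← abs_of_nonneg hw, ← abs_mul, ← intervalIntegral.integral_mul_const, ← Real.norm_eq_abs]
    refine (intervalIntegral.norm_integral_le_of_norm_le ht
      (.of_forall fun s hs => ?_) (hβc.intervalIntegrable _ _))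
    rw [norm_mul, norm_mul, Real.norm_of_nonneg hw, Real.norm_of_nonneg (Real.exp_pos _).le,
      mul_assoc]
    refine le_trans ?_ (hβ s ⟨hs.1.le, hs.2⟩ (x - proj ((t - s) • v)))
    exact mul_le_of_le_one_left (by positivity) (Real.exp_le_one_iff.2 (by linarith [hs.2]))

/-- The solution stays above the transported and damped initial datum. -/
lemma exp_mul_le (H : IsMildSolution G f₀ f) {t : ℝ} (ht : 0 ≤ t)
    (hG : ∀ s ∈ Icc 0 t, ∀ x v, 0 ≤ G (f s) x v) (x : Torus d) (v : Vel d) :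
    Real.exp (-t) * f₀ (x - proj (t • v)) v ≤ f t x v := by
  rw [H.duhamel t ht x v]
  refine le_add_of_nonneg_right (intervalIntegral.integral_nonneg ht fun s hs => ?_)
  exact mul_nonneg (Real.exp_pos _).le (hG s hs _ _)

end IsMildSolution

lemma GaussianBounds.exists_weight_le {f₀ : PhaseFun d} (h : GaussianBounds f₀) {q : ℝ}
    (hq : 0 < q) : ∃ N : ℝ, 0 < N ∧ ∀ x v, f₀ x v * (1 + ‖v‖ ^ q) ≤ N := by
  obtain ⟨a, C₁, α, -, hC₁, hα, hb, -, -⟩ := h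
  obtain ⟨C, hC, hg⟩ := exists_weight_mul_gaussian_le (d := d) hq hα
  refine ⟨C₁ * C, by positivity, fun x v => ?_⟩
  have hw := weight_pos q v
  have h1 : (1 : ℝ) ≤ (1 + ‖v‖) ^ 2 := by nlinarith [norm_nonneg v]
  calc f₀ x v * (1 + ‖v‖ ^ q)
      ≤ C₁ * Real.exp (-α * ‖v‖ ^ 2) * (1 + ‖v‖ ^ q) := by gcongr; exact (hb x v).2
    _ = C₁ * (1 * (1 + ‖v‖ ^ q) * Real.exp (-α * ‖v‖ ^ 2)) := by ring
    _ ≤ C₁ * ((1 + ‖v‖) ^ 2 * (1 + ‖v‖ ^ q) * Real.exp (-α * ‖v‖ ^ 2)) := by gcongr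
    _ ≤ C₁ * C := by gcongr; exact hg v

/-- A priori bounds, uniform over the averaging operator. -/
theorem exists_apriori_bounds (hd : 1 ≤ d) {f₀ : PhaseFun d} (hf₀ : IsProbDensity f₀)
    (hbd : GaussianBounds f₀) {q τ : ℝ} (hq : (d : ℝ) + 2 < q) (hτ : 0 < τ) :
    ∃ N c : ℝ, 0 < N ∧ 0 < c ∧ ∀ (G S : PhaseFun d → PhaseFun d) (f : ℝ → PhaseFun d),
      IsAveragedGain G S → IsMildSolution G f₀ f → ∀ t ∈ Icc 0 τ,
        PhaseBounded q N (f t) ∧ (∀ x, c ≤ mass (f t x)) ∧ ∀ x, c ≤ mass (S (f t) x) := by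
  have hq0 : 0 < q := by linarith [(Nat.cast_nonneg d : (0 : ℝ) ≤ d)]
  obtain ⟨N₀, hN₀, h0⟩ := hbd.exists_weight_le hq0
  obtain ⟨a, C₁, α, -, -, -, hab, ha0, haint⟩ := hbd
  obtain ⟨A, hA, hgain⟩ := exists_localGain_le hd hq
  have hai : Integrable a := Integrable.of_integral_ne_zero haint.ne'
  refine ⟨2 * N₀ * Real.exp (2 * A * τ), Real.exp (-τ) * ∫ v, a v, by positivity, by positivity,
    fun G S f hG H => ?_⟩
  set c := Real.exp (-τ) * ∫ v, a v with hc
  have hc0 : 0 < c := by positivity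
  obtain ⟨q', N', hq', hb'⟩ := H.exists_phaseBounded hτ
  have hpos : ∀ s ∈ Icc 0 τ, ∀ x v, 0 ≤ G (f s) x v := fun s hs x v => by
    have hW := hG.weightBounded hq' (hb' s hs) x
    rw [hG.gain_eq hq' (hb' s hs)]
    exact mul_nonneg hW.mass_nonneg (maxwellian_nonneg hW.temp_nonneg v)
  -- The lower bound a(v) does not depend on x, so it survives transport; the resulting mass bound
  -- does not depend on the solution or on its exponent q'.
  have hlow : ∀ s ∈ Icc 0 τ, ∀ x v, Real.exp (-τ) * a v ≤ f s x v := fun s hs x v => by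
    refine le_trans ?_ (H.exp_mul_le hs.1 (fun r hr => hpos r ⟨hr.1, hr.2.trans hs.2⟩) x v)
    exact mul_le_mul (Real.exp_le_exp.2 (by linarith [hs.2])) (hab _ v).1 (ha0 v)
      (Real.exp_pos _).le
  have hmass : ∀ h : Vel d → ℝ, WeightBounded q' N' h →
      (∀ v, Real.exp (-τ) * a v ≤ h v) → c ≤ mass h := fun h hW hl => by
    rw [hc, ← integral_const_mul]
    exact integral_mono (hai.const_mul _) (hW.integrable hq') hl
  have hmS : ∀ s ∈ Icc 0 τ, ∀ x, c ≤ mass (S (f s) x) := fun s hs x =>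
    hmass _ (hG.weightBounded hq' (hb' s hs) x) fun v => hG.lower (hb' s hs) (hlow s hs) x v
  have hstart : ∀ t ∈ Icc 0 τ, ∀ p : Torus d × Vel d,
      f t p.1 p.2 * (1 + ‖p.2‖ ^ q) ≤ 2 * N₀ * Real.exp (2 * A * t) := by
    have hN' : 0 ≤ N' := ((hb' 0 ⟨le_rfl, hτ.le⟩).weightBounded 0).const_nonneg
    -- The q'-bound is converted into some finite q-bound. It depends on the solution, but Gronwall
    -- needs only finiteness and returns a bound in terms of N₀ and A.
    obtain ⟨C', hC', hgb⟩ := exists_localGain_bound hd (r := q) hq' hq0 hN' hc0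
    have hM : ∀ t ∈ Icc 0 τ, ∀ p : Torus d × Vel d,
        f t p.1 p.2 * (1 + ‖p.2‖ ^ q) ≤ N₀ + τ * C' := fun t ht p => by
      have h1 := H.le_of_gain_le ht.1 (weight_pos q p.2).le (fun x => hf₀.nonneg x p.2)
        (fun x => h0 x p.2) (β := fun _ => C') continuous_const (fun s hs x => by
          have hs' : s ∈ Icc 0 τ := ⟨hs.1, hs.2.trans ht.2⟩
          rw [abs_of_nonneg (hpos s hs' x p.2), hG.gain_eq hq' (hb' s hs')]
          exact hgb _ (hG.weightBounded hq' (hb' s hs') x) (hmS s hs' x) p.2) p.1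
      rw [intervalIntegral.integral_const, sub_zero, smul_eq_mul] at h1
      refine h1.trans ?_
      gcongr
      exact ht.2
    refine gronwall_family hN₀.le hA hM fun m hm hFm t ht p => ?_
    refine H.le_of_gain_le ht.1 (weight_pos q p.2).le (fun x => hf₀.nonneg x p.2)
        (fun x => h0 x p.2) (by fun_prop) (fun s hs x => ?_) p.1
    have hs' : s ∈ Icc 0 τ := ⟨hs.1, hs.2.trans ht.2⟩
    have hPB : PhaseBounded q (m * Real.exp (2 * A * s)) (f s) :=
      ⟨H.measurable_at hs.1, H.nonneg s hs.1, fun x v => hFm s hs' (x, v)⟩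
    rw [abs_of_nonneg (hpos s hs' x p.2), hG.gain_eq hq hPB]
    exact hgain _ _ (hG.weightBounded hq hPB x) (hc0.trans_le (hmS s hs' x)) p.2
  intro t ht
  refine ⟨⟨H.measurable_at ht.1, H.nonneg t ht.1, fun x v => (hstart t ht (x, v)).trans ?_⟩,
    fun x => hmass _ ((hb' t ht).weightBounded x) (hlow t ht x), hmS t ht⟩
  gcongr
  exact ht.2

/-- Propagation of Lipschitz regularity in space. -/
theorem exists_lipschitz_bound (hd : 1 ≤ d) {q τ N c L₀ : ℝ} (hq : (d : ℝ) + 2 < q)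
    (hN : 0 < N) (hc : 0 < c) (hL₀ : 0 ≤ L₀) :
    ∃ L : ℝ, 0 ≤ L ∧ ∀ (f₀ : PhaseFun d) (f : ℝ → PhaseFun d),
      (∀ x z v, |f₀ (x + proj z) v - f₀ x v| * (1 + ‖v‖ ^ q) ≤ L₀ * ‖z‖) →
      IsBGKSolution f₀ f →
      (∀ t ∈ Icc 0 τ, PhaseBounded q N (f t) ∧ ∀ x, c ≤ mass (f t x)) →
      ∀ t ∈ Icc 0 τ, ∀ x z v,
        |f t (x + proj z) v - f t x v| * (1 + ‖v‖ ^ q) ≤ L * ‖z‖ := by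
  obtain ⟨C, hC, hlip⟩ := exists_localGain_lipschitz hd hq hN.le hc
  refine ⟨2 * L₀ * Real.exp (2 * C * τ), by positivity, fun f₀ f h0 H hb t ht x z v => ?_⟩
  have key : ∀ t ∈ Icc 0 τ, ∀ p : Torus d × Vel d,
      |f t (p.1 + proj z) p.2 - f t p.1 p.2| * (1 + ‖p.2‖ ^ q) ≤
        2 * (L₀ * ‖z‖) * Real.exp (2 * C * t) := by
    -- With z fixed, the increment itself satisfies a Gronwall inequality, so the equation need not
    -- be differentiated.
    refine gronwall_family (M := N + N) (by positivity) hC (fun t ht p => ?_)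
      fun m hm hFm t ht p => ?_
    · obtain ⟨hP, -⟩ := hb t ht
      have hw := (weight_pos q p.2).le
      have h1 := hP.bound (p.1 + proj z) p.2
      have h2 := hP.bound p.1 p.2
      have h3 : |f t (p.1 + proj z) p.2 - f t p.1 p.2| ≤
          f t (p.1 + proj z) p.2 + f t p.1 p.2 := by
        have e1 := hP.nonneg (p.1 + proj z) p.2
        have e2 := hP.nonneg p.1 p.2
        rw [abs_le]; constructor <;> linarith
      calc _ ≤ (f t (p.1 + proj z) p.2 + f t p.1 p.2) * (1 + ‖p.2‖ ^ q) := by gcongr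
        _ ≤ N + N := by linarith
    · refine H.abs_sub_le_of_gain_sub_le H ht.1 (weight_pos q p.2).le
        (fun x => h0 x z p.2) (by fun_prop) (fun s hs x => ?_) p.1
      have hs' : s ∈ Icc 0 τ := ⟨hs.1, hs.2.trans ht.2⟩
      obtain ⟨hP, hmass⟩ := hb s hs'
      exact hlip _ _ _ (hP.weightBounded _) (hP.weightBounded _) (hmass _) (hmass _)
        (fun v => hFm s hs' (x, v)) p.2
  refine (key t ht (x, v)).trans ?_
  have : Real.exp (2 * C * t) ≤ Real.exp (2 * C * τ) := by gcongr; exact ht.2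
  calc 2 * (L₀ * ‖z‖) * Real.exp (2 * C * t) ≤ 2 * (L₀ * ‖z‖) * Real.exp (2 * C * τ) := by gcongr
    _ = _ := by ring

/-! ### The covering map and smearing -/

lemma proj_add (z w : Vel d) : proj (z + w) = proj z + proj w := by
  funext i; simp [proj]

lemma proj_neg (z : Vel d) : proj (-z) = -proj z := by
  funext i; simp [proj]

lemma proj_sub (z w : Vel d) : proj (z - w) = proj z - proj w := by
  rw [sub_eq_add_neg, proj_add, proj_neg, sub_eq_add_neg]

lemma isOpenQuotientMap_proj : IsOpenQuotientMap (proj (d := d)) := by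
  have h1 : IsOpenQuotientMap (Pi.map fun (_ : Fin d) (r : ℝ) => (r : UnitAddCircle)) :=
    IsOpenQuotientMap.piMap fun _ => QuotientAddGroup.isOpenQuotientMap_mk
  exact h1.comp (EuclideanSpace.equiv (Fin d) ℝ).toHomeomorph.isOpenQuotientMap

lemma TorusContDiff.continuous {n : WithTop ℕ∞} {J : Torus d → ℝ} (h : TorusContDiff n J) :
    Continuous J :=
  isOpenQuotientMap_proj.isQuotientMap.continuous_iff.2 (ContDiff.continuous h)

lemma supNorm_le_ofReal {α E : Type*} [SeminormedAddGroup E] {F : α → E} {b : ℝ}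
    (h : ∀ x, ‖F x‖ ≤ b) : supNorm F ≤ ENNReal.ofReal b :=
  iSup_le fun x => by
    rw [← ofReal_norm]; exact ENNReal.ofReal_le_ofReal (h x)

lemma norm_le_of_supNorm_le {α E : Type*} [SeminormedAddGroup E] {F : α → E} {b : ℝ}
    (hb : 0 ≤ b) (h : supNorm F ≤ ENNReal.ofReal b) (x : α) : ‖F x‖ ≤ b := by
  have h1 := (le_iSup (fun x => ‖F x‖ₑ) x).trans h
  rw [← ofReal_norm] at h1
  exact (ENNReal.ofReal_le_ofReal_iff hb).1 h1

/-- Spatial average of a phase-space function with kernel `φ`. -/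
def average (φ : Torus d → ℝ) (h : PhaseFun d) : PhaseFun d :=
  fun x v => torusConv φ (fun y => h y v) x

namespace IsSmearing

variable {φ : Torus d → ℝ}

lemma continuous (hφ : IsSmearing φ) : Continuous φ := hφ.smooth.continuous

lemma integrable_translate (hφ : IsSmearing φ) (x : Torus d) : Integrable fun y => φ (x - y) :=
  (hφ.continuous.comp (continuous_const.sub continuous_id)).integrable_of_hasCompactSupport
    (HasCompactSupport.of_compactSpace _)

lemma integral_translate (hφ : IsSmearing φ) (x : Torus d) : ∫ y, φ (x - y) = 1 := by
  have h1 : ∀ y, φ (x - y) = φ (y - x) := fun y => by rw [← hφ.even, neg_sub]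
  simp_rw [h1]
  rw [integral_sub_right_eq_self φ x, hφ.integral_eq_one]

lemma integrable_mul (hφ : IsSmearing φ) {J : Torus d → ℝ} (hJ : Measurable J) {B : ℝ}
    (hB : ∀ y, |J y| ≤ B) (x : Torus d) : Integrable fun y => φ (x - y) * J y :=
  (hφ.integrable_translate x).mul_bdd hJ.aestronglyMeasurable (.of_forall hB)

lemma torusConv_mono (hφ : IsSmearing φ) {J J' : Torus d → ℝ} (hJ : Measurable J)
    (hJ' : Measurable J') {B B' : ℝ} (hB : ∀ y, |J y| ≤ B) (hB' : ∀ y, |J' y| ≤ B')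
    (h : ∀ y, J y ≤ J' y) (x : Torus d) : torusConv φ J x ≤ torusConv φ J' x :=
  integral_mono (hφ.integrable_mul hJ hB x) (hφ.integrable_mul hJ' hB' x)
    fun y => mul_le_mul_of_nonneg_left (h y) (hφ.pos _).le

lemma torusConv_const (hφ : IsSmearing φ) (b : ℝ) (x : Torus d) :
    torusConv φ (fun _ => b) x = b := by
  rw [torusConv, integral_mul_const, hφ.integral_translate, one_mul]

lemma abs_torusConv_sub_le (hφ : IsSmearing φ) {J J' : Torus d → ℝ} (hJ : Measurable J)
    (hJ' : Measurable J') {B B' δ : ℝ} (hB : ∀ y, |J y| ≤ B) (hB' : ∀ y, |J' y| ≤ B')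
    (h : ∀ y, |J y - J' y| ≤ δ) (x : Torus d) : |torusConv φ J x - torusConv φ J' x| ≤ δ := by
  rw [torusConv, torusConv, ← integral_sub (hφ.integrable_mul hJ hB x)
    (hφ.integrable_mul hJ' hB' x), ← Real.norm_eq_abs]
  refine (norm_integral_le_of_norm_le ((hφ.integrable_translate x).mul_const δ)
    (.of_forall fun y => ?_)).trans_eq ?_
  · rw [← mul_sub, norm_mul, Real.norm_of_nonneg (hφ.pos _).le]
    exact mul_le_mul_of_nonneg_left (h y) (hφ.pos _).le
  · rw [integral_mul_const, hφ.integral_translate, one_mul]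

end IsSmearing

namespace PhaseBounded

variable {q N : ℝ} {h : PhaseFun d}

lemma measurable_space (H : PhaseBounded q N h) (v : Vel d) : Measurable fun y => h y v :=
  H.measurable.comp measurable_prodMk_right

lemma abs_le (H : PhaseBounded q N h) (y : Torus d) (v : Vel d) : |h y v| ≤ N / (1 + ‖v‖ ^ q) := by
  rw [le_div_iff₀ (weight_pos q v)]
  exact (H.weightBounded y).abs_bound v

end PhaseBounded

/-- Fubini: smearing the moments is the same as taking moments of the averaged density. -/
lemma integral_integral_smul_eq {E : Type*} [NormedAddCommGroup E] [NormedSpace ℝ E]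
    [CompleteSpace E] {φ : Torus d → ℝ} (hφ : IsSmearing φ) {q N B : ℝ}
    {h : PhaseFun d} (hq : (d : ℝ) + 2 < q) (H : PhaseBounded q N h) {F : Vel d → E}
    (hF : Continuous F) (hB : ∀ v, ‖F v‖ ≤ B * (1 + ‖v‖ ^ 2)) (x : Torus d) :
    ∫ y, ∫ v, (φ (x - y) * h y v) • F v = ∫ v, average φ h x v • F v := by
  have hφm : Measurable fun y => φ (x - y) :=
    (hφ.continuous.comp (continuous_const.sub continuous_id)).measurable
  have hint : Integrable (Function.uncurry fun (y : Torus d) (v : Vel d) =>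
      (φ (x - y) * h y v) • F v) (volume.prod volume) := by
    refine ((hφ.integrable_translate x).mul_prod
      ((integrable_weight hq).const_mul (N * B))).mono' ?_ (.of_forall fun p => ?_)
    · exact (((hφm.comp measurable_fst).mul H.measurable).aestronglyMeasurable.smul
        (hF.comp continuous_snd).aestronglyMeasurable)
    · obtain ⟨y, v⟩ := p
      have h1 := H.abs_le y v
      have h2 : 0 ≤ N / (1 + ‖v‖ ^ q) := (abs_nonneg _).trans h1
      simp only [Function.uncurry]
      rw [norm_smul, norm_mul, Real.norm_of_nonneg (hφ.pos _).le, mul_assoc]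
      refine mul_le_mul_of_nonneg_left ?_ (hφ.pos _).le
      calc ‖h y v‖ * ‖F v‖ ≤ N / (1 + ‖v‖ ^ q) * (B * (1 + ‖v‖ ^ 2)) :=
            mul_le_mul h1 (hB v) (norm_nonneg _) h2
        _ = _ := by ring
  rw [integral_integral_swap hint]
  refine integral_congr_ae (.of_forall fun v => ?_)
  exact integral_smul_const _ _

/-- A probability kernel preserves pointwise bounds. The smeared temperature is centred at the
smeared velocity of the same point x, so it is exactly the temperature of the averaged density. -/
lemma isAveragedGain_smearedGain {φ : Torus d → ℝ} (hφ : IsSmearing φ) :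
    IsAveragedGain (smearedGain φ) (average φ) where
  weightBounded {q N h} hq H x := by
    refine ⟨?_, fun v => integral_nonneg fun y => mul_nonneg (hφ.pos _).le (H.nonneg y v),
      fun v => ?_⟩
    · have hφm : Measurable fun y => φ (x - y) :=
        (hφ.continuous.comp (continuous_const.sub continuous_id)).measurable
      have h1 : Measurable fun p : Vel d × Torus d => φ (x - p.2) * h p.2 p.1 :=
        (hφm.comp measurable_snd).mul (H.measurable.comp measurable_swap)
      exact h1.stronglyMeasurable.integral_prod_right.measurable
    · rw [← le_div_iff₀ (weight_pos q v), ← hφ.torusConv_const (N / _) x]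
      exact hφ.torusConv_mono (H.measurable_space v) measurable_const (fun y => H.abs_le y v)
        (fun _ => le_rfl) (fun y => (le_abs_self _).trans (H.abs_le y v)) x
  lower {q N h b} H hb x v := by
    rw [← hφ.torusConv_const (b v) x]
    exact hφ.torusConv_mono measurable_const (H.measurable_space v) (fun _ => le_rfl)
      (fun y => H.abs_le y v) (fun y => hb y v) x
  gain_eq {q N h} hq H x v := by
    have h0 : smearedDensity φ h x = mass (average φ h x) := by
      have h1 := integral_integral_smul_eq hφ hq H (F := fun _ => (1 : ℝ)) (B := 1)
        continuous_const (fun v => by simp) x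
      simp only [smul_eq_mul, mul_one, integral_const_mul] at h1
      exact h1
    have h1 : smearedVelocity φ h x = mean (average φ h x) := by
      rw [smearedVelocity, mean, h0, integral_integral_smul_eq hφ hq H (F := fun v => v) (B := 1)
        continuous_id (fun v => by nlinarith [sq_nonneg (‖v‖ - 1)])]
    have h2 : smearedTemperature φ h x = temp (average φ h x) := by
      rw [smearedTemperature, temp, h0, h1]
      set u := mean (average φ h x)
      have h3 := integral_integral_smul_eq hφ hq H (F := fun v => ‖v - u‖ ^ 2)
        (B := 2 + 2 * ‖u‖ ^ 2) (by fun_prop) (fun v => by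
          rw [Real.norm_of_nonneg (by positivity)]
          have h1 := norm_sub_le v u
          have h2 : ‖v - u‖ ^ 2 ≤ (‖v‖ + ‖u‖) ^ 2 := by gcongr
          nlinarith [sq_nonneg (‖v‖ - ‖u‖), mul_nonneg (sq_nonneg ‖u‖) (sq_nonneg ‖v‖)]) x
      simp only [smul_eq_mul] at h3
      rw [h3]
    rw [smearedGain, localGain, h0, h1, h2]

/-! ### The approximation property for Lipschitz functions -/

/-- Mollification on the torus by an average over small translations. -/
lemma exists_mollification {J : Torus d → ℝ} {B L η : ℝ} (hη : 0 < η)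
    (hB : ∀ x, |J x| ≤ B) (hL : ∀ x z, |J (x + proj z) - J x| ≤ L * ‖z‖) (hL0 : 0 ≤ L) :
    ∃ J' : Torus d → ℝ, TorusContDiff 1 J' ∧ (∀ x, |J' x| ≤ B) ∧
      (∀ x z, |J' (x + proj z) - J' x| ≤ L * ‖z‖) ∧ ∀ x, |J' x - J x| ≤ L * η := by
  have hcont : ∀ x, Continuous fun z : Vel d => J (x + proj z) := fun x => by
    refine (LipschitzWith.of_dist_le_mul (K := ⟨L, hL0⟩) fun z w => ?_).continuous
    have h1 := hL (x + proj w) (z - w)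
    rw [add_assoc, ← proj_add, add_sub_cancel] at h1
    rwa [Real.dist_eq, dist_eq_norm]
  have hcont' : ∀ x, Continuous fun z : Vel d => J (x - proj z) := fun x => by
    have h1 := (hcont x).comp continuous_neg
    refine h1.congr fun z => ?_
    simp [proj_neg, sub_eq_add_neg]
  let b : ContDiffBump (0 : Vel d) := ⟨η / 2, η, by positivity, by linarith⟩
  have hbi : Integrable (b.normed volume) := b.integrable_normed
  have hb1 : ∫ z, b.normed volume z = 1 := b.integral_normed
  have hb0 : ∀ z, 0 ≤ b.normed volume z := fun z => b.nonneg_normed z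
  have hint : ∀ x, Integrable fun z => b.normed volume z * J (x - proj z) := fun x =>
    hbi.mul_bdd (hcont' x).aestronglyMeasurable (.of_forall fun z => hB _)
  -- An average is bounded by the values on the support of the kernel; all three estimates on J' are
  -- instances.
  have hest : ∀ {F : Vel d → ℝ} {D : ℝ}, (∀ z, b.normed volume z ≠ 0 → |F z| ≤ D) →
      |∫ z, b.normed volume z * F z| ≤ D := fun {F D} hF => by
    rw [← Real.norm_eq_abs]
    refine (norm_integral_le_of_norm_le (hbi.mul_const D) (.of_forall fun z => ?_)).trans_eq ?_
    · rw [norm_mul, Real.norm_of_nonneg (hb0 z)]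
      by_cases hz : b.normed volume z = 0
      · rw [hz, zero_mul, zero_mul]
      · exact mul_le_mul_of_nonneg_left (hF z hz) (hb0 z)
    · rw [integral_mul_const, hb1, one_mul]
  refine ⟨fun x => ∫ z, b.normed volume z * J (x - proj z), ?_, fun x => hest fun z _ => hB _,
    fun x z => ?_, fun x => ?_⟩
  -- The periodic lift of J' is an ordinary convolution on ℝ^d, whose regularity comes from the
  -- bump.
  · have hloc : LocallyIntegrable (fun z : Vel d => J (proj z)) volume := by
      have h1 := hcont 0
      simp only [zero_add] at h1
      exact h1.locallyIntegrable
    have h1 := b.hasCompactSupport_normed.contDiff_convolution_left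
      (ContinuousLinearMap.mul ℝ ℝ) (n := 1) (b.contDiff_normed (μ := volume)) hloc
    have h2 : (fun w : Vel d => ∫ z, b.normed volume z * J (proj w - proj z)) =
        convolution (b.normed volume) (fun z => J (proj z)) (ContinuousLinearMap.mul ℝ ℝ)
          volume := by
      funext w
      simp only [convolution, ContinuousLinearMap.mul_apply', proj_sub]
    rw [TorusContDiff, h2]
    exact h1
  · rw [← integral_sub (hint _) (hint _)]
    simp_rw [← mul_sub]
    refine hest fun w _ => ?_
    have h1 := hL (x - proj w) z
    rwa [sub_add_eq_add_sub] at h1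
  · have h1 : J x = ∫ z, b.normed volume z * J x := by rw [integral_mul_const, hb1, one_mul]
    rw [h1, ← integral_sub (hint _) (hbi.mul_const _)]
    simp_rw [← mul_sub]
    refine hest fun w hw => ?_
    have h2 : w ∈ Function.support (b.normed volume) := hw
    rw [b.support_normed_eq, mem_ball_zero_iff] at h2
    have h3 := hL x (-w)
    rw [proj_neg, ← sub_eq_add_neg, norm_neg] at h3
    exact h3.trans (by gcongr)

lemma norm_torusGrad_le {J : Torus d → ℝ} {L : ℝ} (hL0 : 0 ≤ L)
    (hL : ∀ x z, |J (x + proj z) - J x| ≤ L * ‖z‖) (x : Torus d) : ‖torusGrad J x‖ ≤ L := by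
  rw [torusGrad, gradient, LinearIsometryEquiv.norm_map]
  refine norm_fderiv_le_of_lipschitz ℝ (C := ⟨L, hL0⟩) (LipschitzWith.of_dist_le_mul fun z w => ?_)
  have h1 := hL (x + proj w) (z - w)
  rw [add_assoc, ← proj_add, add_sub_cancel] at h1
  rwa [Real.dist_eq, dist_eq_norm]

/-- The approximation property of a smearing function extends from `C¹` to Lipschitz functions. -/
lemma abs_torusConv_sub_self_le {φ : Torus d → ℝ} (hφ : IsSmearing φ) {K ε : ℝ} (hK : 0 ≤ K)
    (hε : 0 ≤ ε)
    (happ : ∀ J : Torus d → ℝ, TorusContDiff 1 J →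
      supNorm (fun x => torusConv φ J x - J x) ≤
        ENNReal.ofReal K * (supNorm J + supNorm (torusGrad J)) * ENNReal.ofReal ε)
    {J : Torus d → ℝ} (hJ : Measurable J) {B L : ℝ} (hB : ∀ x, |J x| ≤ B) (hL0 : 0 ≤ L)
    (hL : ∀ x z, |J (x + proj z) - J x| ≤ L * ‖z‖) (x : Torus d) :
    |torusConv φ J x - J x| ≤ K * (B + L) * ε := by
  have hB0 : 0 ≤ B := (abs_nonneg _).trans (hB 0)
  -- Mollification keeps B and L, so only the error 2Lη is added, and it vanishes as η → 0.
  have key : ∀ η : ℝ, 0 < η → |torusConv φ J x - J x| ≤ K * (B + L) * ε + 2 * (L * η) := by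
    intro η hη
    obtain ⟨J', hC, hB', hL', hd'⟩ := exists_mollification hη hB hL hL0
    have h1 : supNorm (fun x => torusConv φ J' x - J' x) ≤ ENNReal.ofReal (K * (B + L) * ε) := by
      refine (happ J' hC).trans ?_
      rw [ENNReal.ofReal_mul (by positivity), ENNReal.ofReal_mul hK, ENNReal.ofReal_add hB0 hL0]
      gcongr
      · exact supNorm_le_ofReal hB'
      · exact supNorm_le_ofReal (norm_torusGrad_le hL0 hL')
    have h2 : |torusConv φ J' x - J' x| ≤ K * (B + L) * ε :=
      norm_le_of_supNorm_le (by positivity) h1 x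
    have h3 := hφ.abs_torusConv_sub_le hC.continuous.measurable hJ hB' hB hd' x
    have h4 := hd' x
    rw [abs_sub_comm] at h3
    calc |torusConv φ J x - J x| = |(torusConv φ J x - torusConv φ J' x) +
          (torusConv φ J' x - J' x) + (J' x - J x)| := by congr 1; ring
      _ ≤ L * η + K * (B + L) * ε + L * η :=
        (abs_add_three _ _ _).trans (add_le_add (add_le_add h3 h2) h4)
      _ = _ := by ring
  have hlim : Filter.Tendsto (fun η : ℝ => K * (B + L) * ε + 2 * (L * η)) (nhdsWithin 0 (Ioi 0))
      (nhds (K * (B + L) * ε + 2 * (L * 0))) :=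
    (Continuous.tendsto (by fun_prop) 0).mono_left nhdsWithin_le_nhds
  rw [mul_zero, mul_zero, add_zero] at hlim
  exact ge_of_tendsto hlim (eventually_mem_nhdsWithin.mono fun η hη => key η hη)

/-- A bound on the weighted gradient gives a weighted Lipschitz bound. -/
lemma exists_initial_lipschitz {f₀ : PhaseFun d} {q : ℝ}
    (hdiff : ∀ v, TorusDifferentiable fun x => f₀ x v)
    (hgrad : weightedSup q (fun x v => ‖torusGrad (fun y => f₀ y v) x‖) < ⊤) :
    ∃ L : ℝ, 0 ≤ L ∧ ∀ x z v, |f₀ (x + proj z) v - f₀ x v| * (1 + ‖v‖ ^ q) ≤ L * ‖z‖ := by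
  refine ⟨_, ENNReal.toReal_nonneg (a := weightedSup q (fun x v =>
    ‖torusGrad (fun y => f₀ y v) x‖)), fun x z v => ?_⟩
  set L := (weightedSup q (fun x v => ‖torusGrad (fun y => f₀ y v) x‖)).toReal
  have hw := weight_pos q v
  have hL : ∀ y, ‖torusGrad (fun y => f₀ y v) y‖ ≤ L / (1 + ‖v‖ ^ q) := fun y => by
    rw [le_div_iff₀ hw, ← ENNReal.ofReal_le_iff_le_toReal hgrad.ne]
    exact le_iSup₂ (f := fun (x : Torus d) (v : Vel d) =>
      ENNReal.ofReal (‖torusGrad (fun y => f₀ y v) x‖ * (1 + ‖v‖ ^ q))) y v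
  obtain ⟨x₀, rfl⟩ := isOpenQuotientMap_proj.surjective x
  -- `torusGrad` differentiates a translate at 0; this identifies it with the derivative of the
  -- lift, to which the mean value inequality on ℝ^d applies.
  have h1 : ∀ y : Vel d, fderiv ℝ (fun z : Vel d => f₀ (proj z) v) y =
      fderiv ℝ (fun z : Vel d => f₀ (proj y + proj z) v) 0 := fun y => by
    have h2 := fderiv_comp_add_left (𝕜 := ℝ) (f := fun z : Vel d => f₀ (proj z) v) (x := 0) y
    rw [add_zero] at h2
    rw [← h2]
    simp_rw [proj_add]
  have h2 := Convex.norm_image_sub_le_of_norm_fderiv_le (𝕜 := ℝ) (s := univ)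
    (f := fun z : Vel d => f₀ (proj z) v) (x := x₀) (y := x₀ + z) (C := L / (1 + ‖v‖ ^ q))
    (fun y _ => (hdiff v).differentiableAt) (fun y _ => by
      have h3 := hL (proj y)
      rw [torusGrad, gradient, LinearIsometryEquiv.norm_map] at h3
      rw [h1]; exact h3) convex_univ (mem_univ _) (mem_univ _)
  rw [add_sub_cancel_left, proj_add, div_mul_eq_mul_div, le_div_iff₀ hw] at h2
  exact h2

/-! ### The convergence rate -/

/-- Convergence rate of the regularized BGK equation in a weighted sup norm. -/
theorem exists_weighted_sup_rate (hd : 1 ≤ d) {φ : ℝ → Torus d → ℝ} (hφ : IsSmearingFamily φ)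
    {f₀ : PhaseFun d} (hf₀ : IsProbDensity f₀) (hbd : GaussianBounds f₀)
    (hdiff : ∀ v, TorusDifferentiable fun x => f₀ x v)
    {q : ℝ} (hq : (d : ℝ) + 2 < q)
    (hgrad : weightedSup q (fun x v => ‖torusGrad (fun y => f₀ y v) x‖) < ⊤)
    {τ : ℝ} (hτ : 0 < τ) :
    ∃ C : ℝ, 0 ≤ C ∧ ∀ ε ∈ Ioo (0 : ℝ) 1, ∀ f g : ℝ → PhaseFun d,
      IsBGKSolution f₀ f → IsRegularizedBGKSolution (φ ε) f₀ g → ∀ t ∈ Icc 0 τ, ∀ x v,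
        |f t x v - g t x v| * (1 + ‖v‖ ^ q) ≤ C * ε := by
  obtain ⟨L₀, hL₀, hlip₀⟩ := exists_initial_lipschitz hdiff hgrad
  obtain ⟨N, c, hN, hc, hap⟩ := exists_apriori_bounds hd hf₀ hbd hq hτ
  obtain ⟨L, hL, hlip⟩ := exists_lipschitz_bound (τ := τ) hd hq hN hc hL₀
  obtain ⟨A, hA, hgain⟩ := exists_localGain_lipschitz hd hq hN.le hc
  obtain ⟨K, hK, hKb⟩ := hφ.bounds
  refine ⟨2 * (τ * (A * (K * (N + L)))) * Real.exp (2 * A * τ), by positivity,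
    fun ε hε f g Hf Hg t ht x v => ?_⟩
  have hS := hφ.smearing ε hε
  obtain ⟨-, -, -, happ⟩ := hKb ε hε
  have hε0 := hε.1
  have hf := hap _ _ f isAveragedGain_gain Hf
  have hg := hap _ _ g (isAveragedGain_smearedGain hS) Hg
  have hflip := hlip f₀ f hlip₀ Hf fun s hs => ⟨(hf s hs).1, (hf s hs).2.1⟩
  have key : ∀ t ∈ Icc 0 τ, ∀ p : Torus d × Vel d,
      |f t p.1 p.2 - g t p.1 p.2| * (1 + ‖p.2‖ ^ q) ≤
        2 * (τ * (A * (K * (N + L) * ε))) * Real.exp (2 * A * t) := by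
    refine gronwall_family (M := N + N) (by positivity) hA (fun t ht p => ?_)
      fun m hm hFm t ht p => ?_
    · have hw := (weight_pos q p.2).le
      have h1 := (hf t ht).1.bound p.1 p.2
      have h2 := (hg t ht).1.bound p.1 p.2
      have e1 := (hf t ht).1.nonneg p.1 p.2
      have e2 := (hg t ht).1.nonneg p.1 p.2
      have h3 : |f t p.1 p.2 - g t p.1 p.2| ≤ f t p.1 p.2 + g t p.1 p.2 := by
        rw [abs_le]; constructor <;> linarith
      calc _ ≤ (f t p.1 p.2 + g t p.1 p.2) * (1 + ‖p.2‖ ^ q) := by gcongr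
        _ ≤ N + N := by linarith
    -- The common initial datum gives D = 0. In β, the first term is the smearing error of f and the
    -- second the stability term in f - g.
    · have h1 := Hf.abs_sub_le_of_gain_sub_le Hg ht.1 (weight_pos q p.2).le (D := 0) (z := 0)
        (v := p.2) (by simp)
        (β := fun s => A * (K * (N + L) * ε) + A * (m * Real.exp (2 * A * s))) (by fun_prop)
        (fun s hs x => by
          have hs' : s ∈ Icc 0 τ := ⟨hs.1, hs.2.trans ht.2⟩
          obtain ⟨hP, hmf, -⟩ := hf s hs'
          obtain ⟨hP', -, hmg⟩ := hg s hs'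
          rw [add_zero, (isAveragedGain_smearedGain hS).gain_eq hq hP', ← mul_add]
          refine hgain _ _ _ (hP.weightBounded x)
            ((isAveragedGain_smearedGain hS).weightBounded hq hP' x) (hmf x) (hmg x)
            (fun v => ?_) p.2
          have hw := weight_pos q v
          -- At fixed v, the sup and Lipschitz constants of f both carry 1/(1+|v|^q), so the error
          -- keeps the weight. Only the BGK solution f needs spatial regularity.
          have a1 : |torusConv (φ ε) (fun y => f s y v) x - f s x v| ≤
              K * (N / (1 + ‖v‖ ^ q) + L / (1 + ‖v‖ ^ q)) * ε :=
            abs_torusConv_sub_self_le hS hK.le hε0.le happ (hP.measurable_space v)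
              (fun y => hP.abs_le y v) (by positivity) (fun y z => by
                rw [div_mul_eq_mul_div, le_div_iff₀ hw]
                exact hflip s hs' y z v) x
          -- Averaging is a contraction in sup norm, so φ_ε contributes no constant here.
          have a2 : |torusConv (φ ε) (fun y => f s y v) x - average (φ ε) (g s) x v| ≤
              m * Real.exp (2 * A * s) / (1 + ‖v‖ ^ q) :=
            hS.abs_torusConv_sub_le (hP.measurable_space v) (hP'.measurable_space v)
              (fun y => hP.abs_le y v) (fun y => hP'.abs_le y v) (fun y => by
                rw [le_div_iff₀ hw]; exact hFm s hs' (y, v)) x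
          rw [← le_div_iff₀ hw]
          rw [abs_sub_comm] at a1
          refine (abs_sub_le _ (torusConv (φ ε) (fun y => f s y v) x) _).trans
            ((add_le_add a1 a2).trans_eq ?_)
          field_simp) p.1
      rw [add_zero, zero_add, intervalIntegral.integral_add (by simp)
        (Continuous.intervalIntegrable (by fun_prop) _ _), intervalIntegral.integral_const,
        sub_zero, smul_eq_mul] at h1
      refine h1.trans ?_
      gcongr
      exact ht.2
  refine (key t ht (x, v)).trans ?_
  have h1 : Real.exp (2 * A * t) ≤ Real.exp (2 * A * τ) := by gcongr; exact ht.2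
  calc 2 * (τ * (A * (K * (N + L) * ε))) * Real.exp (2 * A * t)
      ≤ 2 * (τ * (A * (K * (N + L) * ε))) * Real.exp (2 * A * τ) := by gcongr
    _ = _ := by ring

end BGK

end

theorem mainTheorem3 (d : ℕ) (hd : 1 ≤ d)
    (φ : ℝ → BGK.Torus d → ℝ) (hφ : BGK.IsSmearingFamily φ)
    (f₀ : BGK.PhaseFun d) (hf₀ : BGK.IsProbDensity f₀) (hbd : BGK.GaussianBounds f₀)
    (hdiff : ∀ v, BGK.TorusDifferentiable fun x => f₀ x v)
    (q : ℝ) (hq : (d : ℝ) + 2 < q)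
    (hgrad : BGK.weightedSup q (fun x v => ‖BGK.torusGrad (fun y => f₀ y v) x‖) < ⊤)
    (t : ℝ) (ht : 0 ≤ t) :
    ∃ C : ℝ, 0 < C ∧ ∀ ε ∈ Set.Ioo (0 : ℝ) 1, ∀ f g : ℝ → BGK.PhaseFun d,
      BGK.IsBGKSolution f₀ f → BGK.IsRegularizedBGKSolution (φ ε) f₀ g →
      Integrable (fun p : BGK.Torus d × BGK.Vel d =>
        (1 + ‖p.2‖ ^ 2) * |f t p.1 p.2 - g t p.1 p.2|) ∧
      ∫ p : BGK.Torus d × BGK.Vel d,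
        (1 + ‖p.2‖ ^ 2) * |f t p.1 p.2 - g t p.1 p.2| ≤ C * ε := by
  -- The horizon must be strictly positive, hence t + 1, which also covers t = 0.
  obtain ⟨C, hC, hrate⟩ := BGK.exists_weighted_sup_rate hd hφ hf₀ hbd hdiff hq hgrad
    (τ := t + 1) (by linarith)
  set D := ∫ p : BGK.Torus d × BGK.Vel d, (1 + ‖p.2‖ ^ 2) / (1 + ‖p.2‖ ^ q) with hD
  have hD0 : 0 ≤ D := integral_nonneg fun p =>
    div_nonneg (by positivity) (BGK.weight_pos q p.2).le
  -- C and D are only known to be nonnegative; the 1 makes the constant positive.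
  refine ⟨C * D + 1, by positivity, fun ε hε f g Hf Hg => ?_⟩
  have hint : Integrable fun p : BGK.Torus d × BGK.Vel d =>
      (1 + ‖p.2‖ ^ 2) / (1 + ‖p.2‖ ^ q) := by
    have h1 := (integrable_const (1 : ℝ) (μ := (volume : Measure (BGK.Torus d)))).mul_prod
      (BGK.integrable_weight (d := d) hq)
    simp only [one_mul] at h1
    exact h1
  have hle : ∀ p : BGK.Torus d × BGK.Vel d, ‖(1 + ‖p.2‖ ^ 2) * |f t p.1 p.2 - g t p.1 p.2|‖ ≤
      C * ε * ((1 + ‖p.2‖ ^ 2) / (1 + ‖p.2‖ ^ q)) := fun p => by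
    have hw := BGK.weight_pos q p.2
    have h1 := hrate ε hε f g Hf Hg t ⟨ht, by linarith⟩ p.1 p.2
    rw [Real.norm_of_nonneg (by positivity), ← mul_div_assoc, le_div_iff₀ hw]
    calc (1 + ‖p.2‖ ^ 2) * |f t p.1 p.2 - g t p.1 p.2| * (1 + ‖p.2‖ ^ q)
        = (|f t p.1 p.2 - g t p.1 p.2| * (1 + ‖p.2‖ ^ q)) * (1 + ‖p.2‖ ^ 2) := by ring
      _ ≤ _ := by gcongr
  have hmeas : Measurable fun p : BGK.Torus d × BGK.Vel d =>
      (1 + ‖p.2‖ ^ 2) * |f t p.1 p.2 - g t p.1 p.2| := by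
    have h1 := (BGK.IsMildSolution.measurable_at Hf ht).sub
      (BGK.IsMildSolution.measurable_at Hg ht)
    have h2 : Measurable fun p : BGK.Torus d × BGK.Vel d => 1 + ‖p.2‖ ^ 2 := by fun_prop
    exact h2.mul (measurable_norm.comp h1)
  refine ⟨(hint.const_mul _).mono' hmeas.aestronglyMeasurable (.of_forall hle), ?_⟩
  refine (Real.le_norm_self _).trans ((norm_integral_le_of_norm_le (hint.const_mul _)
    (.of_forall hle)).trans ?_)
  rw [integral_const_mul, ← hD]
  nlinarith [hε.1]
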